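/- **Setting.** Let $\mathcal I,\mathcal O$ be disjoint finite sets of input and output propositions and $\Sigma=2^{\mathcal I\cup\mathcal O}$. A transition system (implementation) is $\mathcal T=(S,s_0,\tau)$ with $S$ finite and $\tau:S\times 2^{\mathcal I}\to S\times 2^{\mathcal O}$; $|\mathcal T|=|S|$; its traces are the words $\sigma_0\sigma_1\cdots\in\Sigma^\omega$ for which there are states $s_1,s_2,\dots$ with $(s_{i+1},\sigma_i\cap\mathcal O)=\tau(s_i,\sigma_i\cap\mathcal I)$ for all $i\ge 0$; and $\mathcal T\models\varphi$ means that all its traces satisfy the LTL formula $\varphi$. The value of $\mathsf G\psi$ in $\mathcal T$ is $(1,1,1)$ if $\mathcal T\models \mathsf G\psi$, else $(1,1,0)$ if $\mathcal T\models\mathsf{FG}\psi$, else $(1,0,0)$ if $\mathcal T\models\mathsf{GF}\psi$, else $(0,0,0)$. The value of $\mathsf G\varphi_1\wedge\dots\wedge\mathsf G\varphi_n$ is the componentwise sum of the values of the $\mathsf G\varphi_j$; values are compared lexicographically. **Automata.** Let $\varphi,\varphi_1,\dots,\varphi_n$ be LTL formulas over $\mathcal I\cup\mathcal O$, where each $\mathsf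 G\varphi_j$ is a safety specification in the sense that an automaton $\mathcal B^0_j$ as below is given for it. All automata have finitely many states. - $\mathcal A$ (states $Q$) is a universal co-Büchi automaton for $\varphi$, and $\mathcal A_j$ (states $\widehat Q_j$) is one for $\mathsf{GF}\varphi_j$. That is, a transition system satisfies the formula iff, in its product (run graph) with the automaton, every infinite path from an initial node visits the rejecting states only finitely often. - $\mathcal B^0_j$ is a universal Büchi automaton that accepts exactly the words satisfying $\mathsf G\varphi_j$, and whose only non-accepting state is a non-initial sink $\mathrm{rej}_j$ (from $\mathrm{rej}_j$ every letter leads to $\mathrm{rej}_j$ and only there). $\mathcal B_j=\mathit{Relax}_{\mathsf{FG}}(\mathsf G\varphi_j)$ (states $Q_j$) is obtained from it by deleting $\mathrm{rej}_j$ and redirecting each transition $(q,\sigma,\mathrm{rej}_j)$ to all the initial states; the edges $(q,\sigma,q_0)$, $q_0$ initial, obtained in this way are the edges in $\mathit{Rej}_j$. **Constraint system for bound $b\in\mathbb N_{>0}$.** Let $S=\{1,\dots,b\}$ and $s_0=1$. The Boolean variables are $\tau_{s,\sigma_I,s'}$ and $o_{s,\sigma_I}$ (for $o\in\mathcal O$),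 and, for each of the automata $\mathcal A,\mathcal B_j,\mathcal A_j$ with state set $P$, for every $(s,q)\in S\times P$ a Boolean variable ("the annotation of $(s,q)$ is not $\bot$") and the bits of a binary number with as many bits as $b|P|$. The constraints are: - $C_\tau$: for all $s,\sigma_I$ exactly one $\tau_{s,\sigma_I,s'}$ is true. - The annotation constraint of an automaton: the nodes $(s_0,q_0)$, $q_0$ initial, are annotated by numbers; whenever $(s,q)$ is annotated by a number, $\tau_{s,\sigma_I,s'}$ is true, and the automaton has the transition $(q,\sigma,q')$ for the letter $\sigma$ given by $\sigma_I$ and the values of $o_{s,\sigma_I}$, then $(s',q')$ is annotated by a number that is $\ge$ that of $(s,q)$. It must even be $>$ if $q'$ is rejecting (for $\mathcal A$, $\mathcal A_j$), respectively if $(q,\sigma,q')\in\mathit{Rej}_j$ (for $\mathcal B_j$). Call these constraints $C_\lambda$ (for $\mathcal A$), $C^j_\pi$ (for $\mathcal B_j$), $C^j_\lambda$ (for $\mathcal A_j$). The hard constraint is $C_\tau\wedge C_\lambda$. The soft constraints are, for each $j$: $C^j_\pi\wedge$ "all numbers of the annotation for $\mathcal B_j$ are $0$" with weight $1$; $C^j_\pi$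 with weight $n$; $C^j_\pi\vee C^j_\lambda$ with weight $n^2$. The system is brought into clausal form by the definitional (Tseitin) transformation with auxiliary variables, which gives a partial weighted MaxSAT instance. A satisfying assignment makes all hard clauses true; an optimal one moreover maximizes the total weight of the true soft clauses. **Theorem.** (1) The constraint system for bound $b$ is satisfiable iff there is a transition system $\mathcal T$ with $|\mathcal T|\le b$ and $\mathcal T\models\varphi$. (2) If it is satisfiable, an optimal satisfying assignment exists. (3) For every optimal satisfying assignment, the values of the variables $\tau_{s,\sigma_I,s'}$ and $o_{s,\sigma_I}$ define a transition system $\mathcal T^*$ with state set $S$ (so $|\mathcal T^*|=b$) and initial state $s_0$, such that $\mathcal T^*\models\varphi$, and for every transition system $\mathcal T$ with $|\mathcal T|\le b$ and $\mathcal T\models\varphi$ the value of $\mathsf G\varphi_1\wedge\dots\wedge\mathsf G\varphi_n$ in $\mathcal T^*$ is at least its value in $\mathcal T$. -/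

import Mathlib

namespace MaxReal

/-! ### Linear temporal logic -/

/-- LTL formulas over a set `AP` of atomic propositions. -/
inductive LTL (AP : Type*) where
  | tru : LTL AP
  | atom (p : AP) : LTL AP
  | neg (φ : LTL AP) : LTL AP
  | or (φ ψ : LTL AP) : LTL AP
  | next (φ : LTL AP) : LTL AP
  | until (φ ψ : LTL AP) : LTL AP

namespace LTL

variable {AP : Type*}

/-- `F φ = True U φ`. -/
def eventually (φ : LTL AP) : LTL AP := .until .tru φ

/-- `G φ = ¬ F ¬ φ`. -/
def globally (φ : LTL AP) : LTL AP := .neg (eventually (.neg φ))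

/-- Satisfaction of a formula by an infinite word over `2^AP`. -/
def Sat : (ℕ → Finset AP) → LTL AP → Prop
  | _, .tru => True
  | w, .atom p => p ∈ w 0
  | w, .neg φ => ¬ Sat w φ
  | w, .or φ ψ => Sat w φ ∨ Sat w ψ
  | w, .next φ => Sat (fun k => w (k + 1)) φ
  | w, .until φ ψ =>
      ∃ j, Sat (fun k => w (j + k)) ψ ∧ ∀ i, i < j → Sat (fun k => w (i + k)) φ

end LTL

/-! ### Input-output transition systems

The atomic propositions are the disjoint union `Inp ⊕ Out`. For a letter
`σ : Finset (Inp ⊕ Out)`, `σ.toLeft` is its input part and `σ.toRight` its output part;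
`σI.disjSum σO` is the letter with input part `σI` and output part `σO`. -/

/-- An input-output transition system with state set `S`. -/
structure TransSys (S Inp Out : Type*) where
  init : S
  step : S → Finset Inp → S × Finset Out

namespace TransSys

variable {S Inp Out : Type*}

/-- `w` is the trace of some execution of `T`. -/
def IsTrace (T : TransSys S Inp Out) (w : ℕ → Finset (Inp ⊕ Out)) : Prop :=
  ∃ s : ℕ → S, s 0 = T.init ∧
    ∀ i, (s (i + 1), (w i).toRight) = T.step (s i) (w i).toLeft

/-- `T ⊨ φ`: every trace of `T` satisfies `φ`. -/
def Models (T : TransSys S Inp Out) (φ : LTL (Inp ⊕ Out)) : Prop :=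
  ∀ w, T.IsTrace w → LTL.Sat w φ

open scoped Classical in
/-- The value of `G φ` in `T`, a vector in `{0,1}³`. -/
noncomputable def value (T : TransSys S Inp Out) (φ : LTL (Inp ⊕ Out)) : ℕ × ℕ × ℕ :=
  if T.Models φ.globally then (1, 1, 1)
  else if T.Models φ.globally.eventually then (1, 1, 0)
  else if T.Models φ.eventually.globally then (1, 0, 0)
  else (0, 0, 0)

/-- The value of `G φ₁ ∧ … ∧ G φₙ` in `T`; triples are compared lexicographically. -/
noncomputable def valueConj {n : ℕ} (T : TransSys S Inp Out)
    (φ : Fin n → LTL (Inp ⊕ Out)) : ℕ ×ₗ ℕ ×ₗ ℕ :=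
  toLex (∑ i, (T.value (φ i)).1,
    toLex (∑ i, (T.value (φ i)).2.1, ∑ i, (T.value (φ i)).2.2))

end TransSys

/-! ### Universal automata -/

/-- An automaton on infinite words with states `Q` and alphabet `A`. -/
structure Automaton (Q A : Type*) where
  init : Set Q
  trans : Q → A → Q → Prop
  F : Set Q

namespace Automaton

variable {Q A S Inp Out : Type*}

/-- `r` is a run of the automaton on the word `w`. -/
def IsRun (M : Automaton Q A) (w : ℕ → A) (r : ℕ → Q) : Prop :=
  r 0 ∈ M.init ∧ ∀ i, M.trans (r i) (w i) (r (i + 1))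

/-- Acceptance of a word by a universal Büchi automaton. -/
def BuchiAccepts (M : Automaton Q A) (w : ℕ → A) : Prop :=
  ∀ r, M.IsRun w r → {i | r i ∈ M.F}.Infinite

/-- The labelled edges of the run graph of a universal automaton on a transition system. -/
def RunGraphEdge (M : Automaton Q (Finset (Inp ⊕ Out))) (T : TransSys S Inp Out)
    (v : S × Q) (σ : Finset (Inp ⊕ Out)) (v' : S × Q) : Prop :=
  M.trans v.2 σ v'.2 ∧ T.step v.1 σ.toLeft = (v'.1, σ.toRight)

/-- The transition system `T` is accepted by the universal co-Büchi automaton `M`: every infinite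
path of the run graph that starts in the initial state of `T` and an initial state of `M` visits
the rejecting states `F` only finitely often. -/
def CoBuchiAcceptsTS (M : Automaton Q (Finset (Inp ⊕ Out))) (T : TransSys S Inp Out) : Prop :=
  ∀ v : ℕ → S × Q, (v 0).1 = T.init → (v 0).2 ∈ M.init →
    (∀ i, ∃ σ, M.RunGraphEdge T (v i) σ (v (i + 1))) → {i | (v i).2 ∈ M.F}.Finite

/-- `M` is a universal co-Büchi automaton for `φ`: it accepts exactly the (finite-state)
transition systems that satisfy `φ`. -/
def IsCoBuchiFor (M : Automaton Q (Finset (Inp ⊕ Out))) (φ : LTL (Inp ⊕ Out)) : Prop :=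
  ∀ (S : Type) [Finite S] (T : TransSys S Inp Out), M.CoBuchiAcceptsTS T ↔ T.Models φ

/-- `M` is a universal Büchi automaton for `φ` whose unique non-accepting state is the
non-initial sink `rej`. -/
structure IsSafetyFor (M : Automaton Q (Finset (Inp ⊕ Out))) (rej : Q)
    (φ : LTL (Inp ⊕ Out)) : Prop where
  accepts_iff : ∀ w, M.BuchiAccepts w ↔ LTL.Sat w φ
  mem_F_iff : ∀ q, q ∈ M.F ↔ q ≠ rej
  sink : ∀ σ q, M.trans rej σ q ↔ q = rej
  rej_not_init : rej ∉ M.init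

/-- The edges of the relaxed automaton that replace the edges into `rej`. -/
def relaxRej (M : Automaton Q A) (rej : Q)
    (q : {q : Q // q ≠ rej}) (σ : A) (q' : {q : Q // q ≠ rej}) : Prop :=
  M.trans q σ rej ∧ (q' : Q) ∈ M.init

/-- The relaxation of `M`: the sink `rej` is removed, and every transition into it is redirected
to all the initial states. -/
def relax (M : Automaton Q A) (rej : Q) : Automaton {q : Q // q ≠ rej} A where
  init := {q | (q : Q) ∈ M.init}
  trans q σ q' := M.trans q σ q' ∨ M.relaxRej rej q σ q'
  F := {q | (q : Q) ∈ M.F}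

end Automaton

/-! ### Partial weighted MaxSAT -/

/-- A literal: a variable together with its sign (`true` for positive). -/
abbrev Literal (V : Type*) := V × Bool

/-- A clause is a disjunction of literals. -/
abbrev Clause (V : Type*) := List (Literal V)

/-- A clause is true under a truth assignment if one of its literals is. -/
def Clause.eval {V : Type*} (c : Clause V) (α : V → Bool) : Bool :=
  c.any fun l => α l.1 == l.2

/-- An instance of partial weighted MaxSAT: hard clauses, and soft clauses with positive
weights. -/
structure MaxSAT (V : Type*) where
  hard : List (Clause V)
  soft : List (Clause V × ℕ+)

namespace MaxSAT

variable {V : Type*}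

/-- `α` is a satisfying assignment: it makes all the hard clauses true. -/
def IsSat (P : MaxSAT V) (α : V → Bool) : Prop := ∀ c ∈ P.hard, c.eval α = true

/-- The sum of the weights of the soft clauses that `α` makes true. -/
def weight (P : MaxSAT V) (α : V → Bool) : ℕ :=
  (P.soft.map fun c => if c.1.eval α then (c.2 : ℕ) else 0).sum

/-- The instance is satisfiable. -/
def Satisfiable (P : MaxSAT V) : Prop := ∃ α, P.IsSat α

/-- `α` is an optimal satisfying assignment. -/
def IsOptimal (P : MaxSAT V) (α : V → Bool) : Prop :=
  P.IsSat α ∧ ∀ β, P.IsSat β → P.weight β ≤ P.weight α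

end MaxSAT

/-! ### Propositional formulas and their clausal form -/

/-- Propositional formulas over the Boolean variables `V`. -/
inductive PropForm (V : Type*) where
  | var (v : V) : PropForm V
  | tru : PropForm V
  | neg (f : PropForm V) : PropForm V
  | and (f g : PropForm V) : PropForm V
  | or (f g : PropForm V) : PropForm V

namespace PropForm

variable {V ι : Type*}

def fls : PropForm V := neg tru

def imp (f g : PropForm V) : PropForm V := or (neg f) g

def iff (f g : PropForm V) : PropForm V := and (imp f g) (imp g f)

/-- Conjunction over a finite index set. -/
noncomputable def bigAnd [Finite ι] (f : ι → PropForm V) : PropForm V :=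
  (((Set.finite_univ (α := ι)).toFinset.toList).map f).foldr and tru

/-- Disjunction over a finite index set. -/
noncomputable def bigOr [Finite ι] (f : ι → PropForm V) : PropForm V :=
  (((Set.finite_univ (α := ι)).toFinset.toList).map f).foldr or fls

/-- The binary number with bits `x (k-1) … x 0` is greater than the one with bits
`y (k-1) … y 0`. -/
def gt (x y : ℕ → V) : ℕ → PropForm V
  | 0 => fls
  | k + 1 => or (and (var (x k)) (neg (var (y k)))) (and (iff (var (x k)) (var (y k))) (gt x y k))

/-- The binary number with bits `x (k-1) … x 0` is at least the one with bits
`y (k-1) … y 0`. -/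
def ge (x y : ℕ → V) : ℕ → PropForm V
  | 0 => tru
  | k + 1 => or (and (var (x k)) (neg (var (y k)))) (and (iff (var (x k)) (var (y k))) (ge x y k))

/-- The binary number with bits `x (k-1) … x 0` is zero. -/
def isZero (x : ℕ → V) : ℕ → PropForm V
  | 0 => tru
  | k + 1 => and (neg (var (x k))) (isZero x k)

/-- The definitional (Tseitin) clauses of a formula: `Sum.inl v` is the variable `v`, and
`Sum.inr f` is an auxiliary variable that names the subformula `f`. The clauses say that every
auxiliary variable has the truth value of the subformula that it names. -/
def clauses : PropForm V → List (Clause (V ⊕ PropForm V))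
  | var v => [[(.inr (var v), false), (.inl v, true)], [(.inr (var v), true), (.inl v, false)]]
  | tru => [[(.inr tru, true)]]
  | neg f =>
      [[(.inr (neg f), false), (.inr f, false)], [(.inr (neg f), true), (.inr f, true)]]
        ++ clauses f
  | and f g =>
      [[(.inr (and f g), false), (.inr f, true)], [(.inr (and f g), false), (.inr g, true)],
        [(.inr (and f g), true), (.inr f, false), (.inr g, false)]]
        ++ clauses f ++ clauses g
  | or f g =>
      [[(.inr (or f g), true), (.inr f, false)], [(.inr (or f g), true), (.inr g, false)],
        [(.inr (or f g), false), (.inr f, true), (.inr g, true)]]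
        ++ clauses f ++ clauses g

end PropForm

/-- The partial weighted MaxSAT instance, in clausal form, of a hard constraint and a list of
weighted soft constraints. -/
def toMaxSAT {V : Type*} (hard : PropForm V) (soft : List (PropForm V × ℕ+)) :
    MaxSAT (V ⊕ PropForm V) where
  hard := [(.inr hard, true)] :: (hard.clauses ++ soft.flatMap fun c => c.1.clauses)
  soft := soft.map fun c => ([(.inr c.1, true)], c.2)

/-! ### The constraint system for bound `b` -/

/-- The Boolean variables of the constraint system. The states of the desired transition system
are `Fin b`; `Q`, `Q₁ j`, `Q₂ j` are the states of `𝒜`, `ℬⱼ`, `𝒜ⱼ`. -/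
inductive EncVar (b n : ℕ) (Inp Out Q : Type*) (Q₁ Q₂ : Fin n → Type*) where
  /-- `τ_{s,σI,s'}`: under input `σI`, state `s` has successor `s'`. -/
  | trans (s : Fin b) (σI : Finset Inp) (s' : Fin b)
  /-- `o_{s,σI}`: under input `σI`, the output proposition `o` is true in state `s`. -/
  | out (s : Fin b) (σI : Finset Inp) (o : Out)
  /-- the annotation of `(s,q)` for `𝒜` is not `⊥` -/
  | lamB (s : Fin b) (q : Q)
  /-- bit `i` of the annotation of `(s,q)` for `𝒜` -/
  | lamN (s : Fin b) (q : Q) (i : ℕ)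
  /-- the annotation of `(s,q)` for `ℬⱼ` is not `⊥` -/
  | piB (j : Fin n) (s : Fin b) (q : Q₁ j)
  /-- bit `i` of the annotation of `(s,q)` for `ℬⱼ` -/
  | piN (j : Fin n) (s : Fin b) (q : Q₁ j) (i : ℕ)
  /-- the annotation of `(s,q)` for `𝒜ⱼ` is not `⊥` -/
  | hatB (j : Fin n) (s : Fin b) (q : Q₂ j)
  /-- bit `i` of the annotation of `(s,q)` for `𝒜ⱼ` -/
  | hatN (j : Fin n) (s : Fin b) (q : Q₂ j) (i : ℕ)

namespace Enc

open PropForm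

variable {b n : ℕ} {Inp Out Q : Type*} {Q₁ Q₂ : Fin n → Type*}

/-- The number of bits of an annotation, enough for the numbers `0, …, b * |P|`. -/
noncomputable def bits (b : ℕ) (P : Type*) : ℕ := Nat.size (b * Nat.card P)

/-- `C_τ`: every state has exactly one successor for every input. -/
noncomputable def cTau [Finite Inp] : PropForm (EncVar b n Inp Out Q Q₁ Q₂) :=
  bigAnd fun s : Fin b => bigAnd fun σI : Finset Inp =>
    and (bigOr fun s' : Fin b => var (.trans s σI s'))
      (bigAnd fun s' : Fin b => bigAnd fun s'' : Fin b =>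
        if s' = s'' then tru else or (neg (var (.trans s σI s'))) (neg (var (.trans s σI s''))))

open scoped Classical in
/-- The formula over the variables `o_{s,σI}` which says that the letter with input part `σI` and
the output part chosen in `s` under `σI` is in the set `L`. -/
noncomputable def letterIn [Finite Out] (L : Finset (Inp ⊕ Out) → Prop) (s : Fin b)
    (σI : Finset Inp) : PropForm (EncVar b n Inp Out Q Q₁ Q₂) :=
  bigOr fun σO : Finset Out =>
    if L (σI.disjSum σO) then
      bigAnd fun o : Out => if o ∈ σO then var (.out s σI o) else neg (var (.out s σI o))
    else fls

open scoped Classical in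
/-- The constraints on an annotation for an automaton `M` with states `P`: the initial nodes are
annotated by numbers; if `(s,p)` is annotated by a number and has an edge to `(s',p')`, then
`(s',p')` is annotated by a number, and the comparison `cmp s p σI s' p'` holds. -/
noncomputable def annotation [Finite Inp] [Finite Out] {P : Type*} [Finite P]
    (M : Automaton P (Finset (Inp ⊕ Out))) (s₀ : Fin b)
    (vB : Fin b → P → EncVar b n Inp Out Q Q₁ Q₂)
    (cmp : Fin b → P → Finset Inp → Fin b → P → PropForm (EncVar b n Inp Out Q Q₁ Q₂)) :
    PropForm (EncVar b n Inp Out Q Q₁ Q₂) :=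
  and (bigAnd fun p : P => if p ∈ M.init then var (vB s₀ p) else tru)
    (bigAnd fun s : Fin b => bigAnd fun p : P => bigAnd fun σI : Finset Inp =>
      bigAnd fun s' : Fin b => bigAnd fun p' : P =>
        imp (and (var (vB s p))
            (and (letterIn (fun σ => M.trans p σ p') s σI) (var (.trans s σI s'))))
          (and (var (vB s' p')) (cmp s p σI s' p')))

open scoped Classical in
/-- Comparison for a co-Büchi automaton: the annotation does not decrease, and it increases when a
rejecting state is entered. -/
noncomputable def coBuchiCmp {P : Type*} (M : Automaton P (Finset (Inp ⊕ Out)))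
    (vN : Fin b → P → ℕ → EncVar b n Inp Out Q Q₁ Q₂)
    (s : Fin b) (p : P) (_ : Finset Inp) (s' : Fin b) (p' : P) :
    PropForm (EncVar b n Inp Out Q Q₁ Q₂) :=
  if p' ∈ M.F then gt (vN s' p') (vN s p) (bits b P) else ge (vN s' p') (vN s p) (bits b P)

/-- Comparison for a relaxed automaton: the annotation does not decrease, and it increases along
the redirected edges. -/
noncomputable def relaxCmp [Finite Out] {P : Type*} (rejEdge : P → Finset (Inp ⊕ Out) → P → Prop)
    (vN : Fin b → P → ℕ → EncVar b n Inp Out Q Q₁ Q₂)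
    (s : Fin b) (p : P) (σI : Finset Inp) (s' : Fin b) (p' : P) :
    PropForm (EncVar b n Inp Out Q Q₁ Q₂) :=
  and (imp (letterIn (fun σ => rejEdge p σ p') s σI) (gt (vN s' p') (vN s p) (bits b P)))
    (imp (neg (letterIn (fun σ => rejEdge p σ p') s σI)) (ge (vN s' p') (vN s p) (bits b P)))

variable [Finite Inp] [Finite Out]

/-- `C_λ`: valid annotation for the co-Büchi automaton of the hard specification. -/
noncomputable def cLam [Finite Q] (A : Automaton Q (Finset (Inp ⊕ Out))) (s₀ : Fin b) :
    PropForm (EncVar b n Inp Out Q Q₁ Q₂) :=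
  annotation A s₀ .lamB (coBuchiCmp A .lamN)

variable {R : Fin n → Type*} [∀ j, Finite (R j)]

/-- `C_π^j`: valid annotation for the relaxation of the automaton `B j` of `G φⱼ`. -/
noncomputable def cPi (B : ∀ j, Automaton (R j) (Finset (Inp ⊕ Out))) (rej : ∀ j, R j)
    (s₀ : Fin b) (j : Fin n) :
    PropForm (EncVar b n Inp Out Q (fun j => {q : R j // q ≠ rej j}) Q₂) :=
  annotation ((B j).relax (rej j)) s₀ (fun s q => .piB j s q)
    (relaxCmp ((B j).relaxRej (rej j)) fun s q i => .piN j s q i)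

/-- `C_λ^j`: valid annotation for the co-Büchi automaton of `G F φⱼ`. -/
noncomputable def cHat [∀ j, Finite (Q₂ j)] (A' : ∀ j, Automaton (Q₂ j) (Finset (Inp ⊕ Out)))
    (s₀ : Fin b) (j : Fin n) : PropForm (EncVar b n Inp Out Q Q₁ Q₂) :=
  annotation (A' j) s₀ (.hatB j) (coBuchiCmp (A' j) (.hatN j))

/-- The soft constraint for `G φⱼ`: a valid annotation for the relaxed automaton that is
everywhere `0`. -/
noncomputable def softG (B : ∀ j, Automaton (R j) (Finset (Inp ⊕ Out))) (rej : ∀ j, R j)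
    (s₀ : Fin b) (j : Fin n) :
    PropForm (EncVar b n Inp Out Q (fun j => {q : R j // q ≠ rej j}) Q₂) :=
  and (cPi B rej s₀ j)
    (bigAnd fun s : Fin b => bigAnd fun q : {q : R j // q ≠ rej j} =>
      isZero (.piN j s q) (bits b {q : R j // q ≠ rej j}))

/-- The constraint system for bound `b`. The hard constraint is `C_τ ∧ C_λ`. For each `j`, the
soft constraints are `Soft_G^j` with weight `1`, `Soft_FG^j = C_π^j` with weight `n`, and
`Soft_GF^j = C_π^j ∨ C_λ^j` with weight `n²`. -/
noncomputable def constraintSystem [Finite Q] [∀ j, Finite (Q₂ j)]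
    (A : Automaton Q (Finset (Inp ⊕ Out)))
    (B : ∀ j, Automaton (R j) (Finset (Inp ⊕ Out))) (rej : ∀ j, R j)
    (A' : ∀ j, Automaton (Q₂ j) (Finset (Inp ⊕ Out))) (s₀ : Fin b) :
    MaxSAT (EncVar b n Inp Out Q (fun j => {q : R j // q ≠ rej j}) Q₂ ⊕
      PropForm (EncVar b n Inp Out Q (fun j => {q : R j // q ≠ rej j}) Q₂)) :=
  toMaxSAT (and cTau (cLam A s₀))
    ((List.finRange n).flatMap fun j =>
      [(softG B rej s₀ j, 1),
       (cPi B rej s₀ j, ⟨n, j.pos⟩),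
       (or (cPi B rej s₀ j) (cHat A' s₀ j), ⟨n, j.pos⟩ ^ 2)])

end Enc

/-- `T` is the transition system that is read off from the values under `α` of the variables
`τ_{s,σI,s'}` and `o_{s,σI}`, with initial state `s₀`. It is unique if it exists. -/
def IsExtracted {b n : ℕ} {Inp Out Q : Type*} {Q₁ Q₂ : Fin n → Type*} {X : Type*}
    (α : EncVar b n Inp Out Q Q₁ Q₂ ⊕ X → Bool) (s₀ : Fin b)
    (T : TransSys (Fin b) Inp Out) : Prop :=
  T.init = s₀ ∧
  (∀ s σI s', α (.inl (.trans s σI s')) = true ↔ (T.step s σI).1 = s') ∧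
  (∀ s σI o, α (.inl (.out s σI o)) = true ↔ o ∈ (T.step s σI).2)

end MaxReal

/-!
The proof reduces every constraint to a statement about paths in finite graphs. Call some edges of
a graph progress edges. A valid annotation assigns numbers to a set of vertices that contains the
initial ones and is closed under edges, such that the numbers do not decrease along edges and
increase along progress edges.

If there is a valid annotation of a finite graph, then no path from an initial vertex uses progress
edges infinitely often (`IsAnnotation.finite_progress`). Conversely, if there is no such path, then
annotating each reachable vertex by the number of progress targets from which it can be reached is
valid, because a progress edge on a reachable cycle would yield such a path
(`exists_isAnnotation`); these numbers are at most the number of vertices, so that they fit into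
the bits provided by the constraint system. The annotation that is everywhere `0` is valid iff no
progress edge is reachable (`exists_isAnnotation_zero`).

For a co-Büchi automaton, progress means entering a rejecting state, and valid annotations exist
exactly for the accepted transition systems. For the relaxation of a safety automaton, progress
means using a redirected edge. A transition system satisfies `G ψ` iff no redirected edge is
reachable (`Automaton.IsSafetyFor.models_iff`). It satisfies `F G ψ` iff no path uses redirected
edges infinitely often (`Automaton.IsSafetyFor.models_eventually_iff`): between two uses, the path
is a run of the original automaton into its sink, and such runs can be concatenated because a
redirected edge leads to every initial state.

The definitional clauses force each auxiliary variable to the truth value of its formula, so the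
weight of a satisfying assignment is that of the soft constraints that hold under it
(`MaxSAT.IsSat.weight_eq`). It is bounded by the weighted sum `TransSys.score` of the entries of
the value of the transition system that is read off (`Enc.exists_transSys_of_isSat`), and every
transition system that meets the hard specification and the bound is described by an assignment that reaches this bound
(`Enc.exists_isSat_of_models`). Here one annotation of the relaxed automaton has to serve all the
soft constraints, so the zero annotation is chosen whenever `G ψ` holds. Finally, comparing scores
amounts to comparing values lexicographically, because the entries of a value decrease from left
to right (`TransSys.toLex_le_of_weight_le`).
-/

namespace MaxReal

/-! ### Annotations of graphs -/

section Graph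

open Relation

variable {X : Type*}

/-- From `x` one can walk `k` edges of `E` and then an edge of both `E` and `D` into `P`. -/
def ReachesIn (E D : X → X → Prop) (P : X → Prop) : ℕ → X → Prop
  | 0, x => ∃ z, E x z ∧ D x z ∧ P z
  | k + 1, x => ∃ y, E x y ∧ ReachesIn E D P k y

theorem exists_reachesIn {E D : X → X → Prop} {P : X → Prop} {x y z : X}
    (hxy : ReflTransGen E x y) (hE : E y z) (hD : D y z) (hz : P z) :
    ∃ k, ReachesIn E D P k x := by
  induction hxy using ReflTransGen.head_induction_on with
  | refl => exact ⟨0, z, hE, hD, hz⟩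
  | head h _ ih =>
    obtain ⟨k, hk⟩ := ih
    exact ⟨k + 1, _, h, hk⟩

/-- Finite walks can be concatenated: if every vertex in `P` has a walk back into `P` whose last
edge is in `D`, then a vertex with such a walk starts an infinite path that uses `D`
infinitely often. The path is followed together with the number of edges left until the next use
of `D`. -/
theorem exists_path_infinite {E D : X → X → Prop} {P : X → Prop}
    (hP : ∀ x, P x → ∃ y z, ReflTransGen E x y ∧ E y z ∧ D y z ∧ P z) {x y z : X}
    (hxy : ReflTransGen E x y) (hE : E y z) (hD : D y z) (hz : P z) :
    ∃ v : ℕ → X, v 0 = x ∧ (∀ i, E (v i) (v (i + 1))) ∧ {i | D (v i) (v (i + 1))}.Infinite := by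
  obtain ⟨k, hk⟩ := exists_reachesIn hxy hE hD hz
  have step : ∀ p : {p : X × ℕ // ReachesIn E D P p.2 p.1},
      ∃ p' : {p : X × ℕ // ReachesIn E D P p.2 p.1}, E p.1.1 p'.1.1 ∧
        (p.1.2 = 0 → D p.1.1 p'.1.1) ∧ ∀ m, p.1.2 = m + 1 → p'.1.2 = m := by
    rintro ⟨⟨x, _ | m⟩, h⟩
    · obtain ⟨z, hE, hD, hz⟩ := h
      obtain ⟨y', z', h₁, h₂, h₃, h₄⟩ := hP z hz
      obtain ⟨m, hm⟩ := exists_reachesIn h₁ h₂ h₃ h₄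
      exact ⟨⟨(z, m), hm⟩, hE, fun _ => hD, by simp⟩
    · obtain ⟨y, hE, hy⟩ := h
      exact ⟨⟨(y, m), hy⟩, hE, by simp, by simp⟩
  choose f hf₁ hf₂ hf₃ using step
  let p : ℕ → {p : X × ℕ // ReachesIn E D P p.2 p.1} := fun i => f^[i] ⟨(x, k), hk⟩
  have hp : ∀ i, p (i + 1) = f (p i) := fun i => Function.iterate_succ_apply' f i _
  have next : ∀ m i, (p i).1.2 = m → ∃ j, i ≤ j ∧ D (p j).1.1 (p (j + 1)).1.1 := by
    intro m
    induction m with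
    | zero => exact fun i hi => ⟨i, le_rfl, by rw [hp]; exact hf₂ _ hi⟩
    | succ m ih =>
      intro i hi
      obtain ⟨j, hj, h⟩ := ih (i + 1) (by rw [hp]; exact hf₃ _ _ hi)
      exact ⟨j, by omega, h⟩
  refine ⟨fun i => (p i).1.1, rfl, fun i => by simpa only [hp] using hf₁ (p i), ?_⟩
  refine Set.infinite_of_forall_exists_gt fun i => ?_
  obtain ⟨j, hj, h⟩ := next _ (i + 1) rfl
  exact ⟨j, h, by omega⟩

/-- A valid annotation of a graph with edges `E`, initial vertices `I`, and progress edges `D`: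
`B` is the set of vertices that are annotated by a number, and `N` gives the numbers (its values
outside `B` are irrelevant). -/
structure IsAnnotation (E D : X → X → Prop) (I : Set X) (B : X → Prop) (N : X → ℕ) : Prop where
  init : ∀ x ∈ I, B x
  closed : ∀ x y, E x y → B x → B y
  le : ∀ x y, E x y → B x → N x ≤ N y
  lt : ∀ x y, E x y → D x y → B x → N x < N y

/-- In a finite graph, the numbers of an annotation grow along a path, so that only finitely many
progress edges can occur on it. -/
theorem IsAnnotation.finite_progress [Finite X] {E D : X → X → Prop} {I : Set X} {B : X → Prop}
    {N : X → ℕ} (h : IsAnnotation E D I B N) {v : ℕ → X} (h0 : v 0 ∈ I)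
    (hv : ∀ i, E (v i) (v (i + 1))) : {i | D (v i) (v (i + 1))}.Finite := by
  have hB : ∀ i, B (v i) := fun i => by
    induction i with
    | zero => exact h.init _ h0
    | succ i ih => exact h.closed _ _ (hv i) ih
  have hmono : Monotone fun i => N (v i) := monotone_nat_of_le_succ fun i => h.le _ _ (hv i) (hB i)
  by_contra hinf
  obtain ⟨i, hi, j, hj, hij, heq⟩ := Set.Infinite.exists_lt_map_eq_of_mapsTo (f := fun i => v i)
    (t := Set.univ) hinf (fun _ _ => Set.mem_univ _) Set.finite_univ
  have h₁ := h.lt _ _ (hv i) hi (hB i)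
  have h₂ : N (v (i + 1)) ≤ N (v j) := hmono (Nat.succ_le_of_lt hij)
  rw [heq] at h₁
  omega

/-- If no path from an initial vertex has infinitely many progress edges, then the following
annotation is valid: a vertex is annotated if it is reachable, by the number of the targets of
reachable progress edges from which it can be reached. A progress edge `x → y` increases the
number, because `y` is among the vertices counted at `y`; it is not counted at `x`, since
otherwise the edge would lie on a cycle. -/
theorem exists_isAnnotation [Finite X] {E D : X → X → Prop} {I : Set X}
    (h : ∀ v : ℕ → X, v 0 ∈ I → (∀ i, E (v i) (v (i + 1))) →
      {i | D (v i) (v (i + 1))}.Finite) :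
    ∃ B N, IsAnnotation E D I B N ∧ ∀ x, N x ≤ Nat.card X := by
  let B : X → Prop := fun x => ∃ x₀ ∈ I, ReflTransGen E x₀ x
  let C : X → Set X := fun x => {u | (∃ t, B t ∧ E t u ∧ D t u) ∧ ReflTransGen E u x}
  have hC : ∀ x y, E x y → C x ⊆ C y := fun x y hxy u hu => ⟨hu.1, hu.2.tail hxy⟩
  refine ⟨B, fun x => (C x).ncard, ⟨fun x hx => ⟨x, hx, .refl⟩, ?_, ?_, ?_⟩,
    fun x => Set.ncard_le_card _⟩
  · rintro x y hxy ⟨x₀, h₀, hx⟩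
    exact ⟨x₀, h₀, hx.tail hxy⟩
  · exact fun x y hxy _ => Set.ncard_le_ncard (hC x y hxy) (Set.toFinite _)
  · intro x y hxy hD hB
    refine Set.ncard_lt_ncard ⟨hC x y hxy, fun hsub => ?_⟩ (Set.toFinite _)
    have hy : y ∈ C x := hsub ⟨⟨x, hB, hxy, hD⟩, .refl⟩
    obtain ⟨x₀, h₀, hx⟩ := hB
    obtain ⟨v, hv0, hv, hinf⟩ := exists_path_infinite (P := fun z => z = y)
      (fun z hz => ⟨x, y, hz ▸ hy.2, hxy, hD, rfl⟩) hx hxy hD rfl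
    exact hinf (h v (hv0 ▸ h₀) hv)

/-- The annotation that is everywhere `0` is valid iff no progress edge is reachable. -/
theorem exists_isAnnotation_zero {E D : X → X → Prop} {I : Set X} :
    (∃ B, IsAnnotation E D I B fun _ => 0) ↔
      ∀ x₀ ∈ I, ∀ x, ReflTransGen E x₀ x → ∀ y, E x y → ¬ D x y := by
  constructor
  · rintro ⟨B, h⟩ x₀ h₀ x hx y
    have hB : B x := by
      induction hx with
      | refl => exact h.init _ h₀
      | tail _ h' ih => exact h.closed _ _ h' ih
    exact fun hxy hD => lt_irrefl _ (h.lt x y hxy hD hB)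
  · intro h
    refine ⟨fun x => ∃ x₀ ∈ I, ReflTransGen E x₀ x, fun x hx => ⟨x, hx, .refl⟩, ?_,
      fun _ _ _ _ => le_rfl, ?_⟩
    · rintro x y hxy ⟨x₀, h₀, hx⟩
      exact ⟨x₀, h₀, hx.tail hxy⟩
    · rintro x y hxy hD ⟨x₀, h₀, hx⟩
      exact absurd hD (h x₀ h₀ x hx y hxy)

end Graph

/-! ### Temporal operators and traces -/

namespace LTL

variable {AP : Type*}

theorem sat_eventually (w : ℕ → Finset AP) (φ : LTL AP) :
    Sat w φ.eventually ↔ ∃ k, Sat (fun i => w (k + i)) φ := by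
  simp [eventually, Sat]

theorem sat_globally (w : ℕ → Finset AP) (φ : LTL AP) :
    Sat w φ.globally ↔ ∀ k, Sat (fun i => w (k + i)) φ := by
  simp [globally, Sat, sat_eventually]

theorem Sat.globally_suffix {w : ℕ → Finset AP} {φ : LTL AP} {k m : ℕ}
    (h : Sat (fun i => w (k + i)) φ.globally) (hkm : k ≤ m) :
    Sat (fun i => w (m + i)) φ.globally := by
  rw [sat_globally] at h ⊢
  intro l
  have := h (m - k + l)
  simpa only [← add_assoc, Nat.add_sub_cancel' hkm] using this

end LTL

/-! ### Universal automata and transition systems -/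

namespace Automaton

open Relation

variable {Q S Inp Out : Type*}

/-- The edges of the run graph of `M` on `T`, without their letters. -/
def Edge (M : Automaton Q (Finset (Inp ⊕ Out))) (T : TransSys S Inp Out) (x y : S × Q) : Prop :=
  ∃ σ, M.RunGraphEdge T x σ y

/-- The initial vertices of the run graph of `M` on `T`. -/
def Start (M : Automaton Q (Finset (Inp ⊕ Out))) (T : TransSys S Inp Out) : Set (S × Q) :=
  {x | x.1 = T.init ∧ x.2 ∈ M.init}

/-- The pairs of vertices of the run graph of `relax M rej` on `T` between which some redirected
edge runs. -/
def RejEdge (M : Automaton Q (Finset (Inp ⊕ Out))) (rej : Q) (T : TransSys S Inp Out)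
    (x y : S × {q : Q // q ≠ rej}) : Prop :=
  ∃ σ, M.relaxRej rej x.2 σ y.2 ∧ T.step x.1 σ.toLeft = (y.1, σ.toRight)

/-- Acceptance by a co-Büchi automaton in terms of the edges that enter rejecting states. -/
theorem coBuchiAcceptsTS_iff (M : Automaton Q (Finset (Inp ⊕ Out))) (T : TransSys S Inp Out) :
    M.CoBuchiAcceptsTS T ↔ ∀ v : ℕ → S × Q, v 0 ∈ M.Start T →
      (∀ i, M.Edge T (v i) (v (i + 1))) → {i | (v (i + 1)).2 ∈ M.F}.Finite := by
  have key : ∀ v : ℕ → S × Q, {i | (v i).2 ∈ M.F}.Finite ↔ {i | (v (i + 1)).2 ∈ M.F}.Finite := by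
    intro v
    constructor
    · exact fun h => Set.Finite.preimage (f := fun i : ℕ => i + 1)
        (fun _ _ _ _ h => Nat.succ_injective h) h
    · intro h
      refine ((h.image (fun i => i + 1)).insert 0).subset ?_
      rintro (_ | i) hi
      · exact Set.mem_insert _ _
      · exact Set.mem_insert_of_mem _ ⟨i, hi, rfl⟩
  constructor
  · exact fun h v h0 hv => (key v).1 (h v h0.1 h0.2 hv)
  · exact fun h v h0 h0' hv => (key v).2 (h v ⟨h0, h0'⟩ hv)

namespace IsSafetyFor

variable {M : Automaton Q (Finset (Inp ⊕ Out))} {rej : Q} {φ : LTL (Inp ⊕ Out)}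

/-- A word violates the safety property iff a finite run on it ends in the rejecting sink. -/
theorem not_sat_iff (h : M.IsSafetyFor rej φ) (w : ℕ → Finset (Inp ⊕ Out)) :
    ¬ LTL.Sat w φ ↔ ∃ (r : ℕ → Q) (k : ℕ), r 0 ∈ M.init ∧
      (∀ i < k, M.trans (r i) (w i) (r (i + 1))) ∧ r k = rej := by
  rw [← h.accepts_iff]
  constructor
  · intro hw
    simp only [BuchiAccepts, not_forall] at hw
    obtain ⟨r, hr, hfin⟩ := hw
    obtain ⟨k, hk⟩ := (Set.not_infinite.1 hfin).exists_notMem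
    rw [Set.mem_ofPred_eq, h.mem_F_iff, not_not] at hk
    exact ⟨r, k, hr.1, fun i _ => hr.2 i, hk⟩
  · rintro ⟨r, k, h0, hr, hk⟩ hacc
    -- After the finite run has reached the sink, it stays there.
    refine hacc (fun i => if i ≤ k then r i else rej) ⟨by simpa using h0, fun i => ?_⟩
      ((Set.finite_lt_nat k).subset fun i hi => ?_)
    · rcases lt_trichotomy i k with hi | rfl | hi
      · simpa [hi.le, Nat.succ_le_of_lt hi] using hr i hi
      · simp [hk, (h.sink _ _).2]
      · simp [hi.not_ge, (Nat.lt_succ_of_lt hi).not_ge, (h.sink _ _).2]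
    · rw [Set.mem_ofPred_eq, h.mem_F_iff] at hi
      by_contra hik
      rw [Set.mem_ofPred_eq, not_lt] at hik
      rcases hik.eq_or_lt with rfl | hlt
      · simp [hk] at hi
      · simp [hlt.not_ge] at hi

/-- If the suffix of `w` from position `k` on violates the safety property, then a walk of the
relaxed automaton starts in an initial state at `k` and reaches, at some later position `m`, a
state with a transition into the sink. -/
theorem exists_walk_of_not_sat (h : M.IsSafetyFor rej φ) {w : ℕ → Finset (Inp ⊕ Out)} {k : ℕ}
    (hw : ¬ LTL.Sat (fun i => w (k + i)) φ) :
    ∃ q : {q : Q // q ≠ rej}, (q : Q) ∈ M.init ∧ ∃ (m : ℕ) (p : {q : Q // q ≠ rej}),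
      ReflTransGen (fun x y : ℕ × {q : Q // q ≠ rej} =>
        y.1 = x.1 + 1 ∧ (M.relax rej).trans x.2 (w x.1) y.2) (k, q) (m, p) ∧
      M.trans p (w m) rej := by
  classical
  obtain ⟨r, l, h0, hr, hl⟩ := (h.not_sat_iff _).1 hw
  have hex : ∃ l, r l = rej := ⟨l, hl⟩
  have hle : Nat.find hex ≤ l := Nat.find_min' hex hl
  have hspec := Nat.find_spec hex
  have hmin : ∀ i, i < Nat.find hex → r i ≠ rej := fun i hi => Nat.find_min hex hi
  generalize Nat.find hex = f at hle hspec hmin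
  obtain _ | m := f
  · exact absurd (hspec ▸ h0) h.rej_not_init
  have walk : ∀ i (hi : i ≤ m), ReflTransGen (fun x y : ℕ × {q : Q // q ≠ rej} =>
      y.1 = x.1 + 1 ∧ (M.relax rej).trans x.2 (w x.1) y.2)
      (k, ⟨r 0, hmin 0 (by omega)⟩) (k + i, ⟨r i, hmin i (by omega)⟩) := by
    intro i
    induction i with
    | zero => exact fun _ => .refl
    | succ i ih =>
      exact fun hi => (ih (by omega)).tail ⟨rfl, Or.inl (hr i (by omega))⟩
  refine ⟨_, h0, _, _, walk m le_rfl, ?_⟩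
  have hlast := hr m (by omega)
  rwa [hspec] at hlast

/-- A transition system satisfies the safety property iff no redirected edge is reachable in the
run graph of the relaxed automaton. -/
theorem models_iff (h : M.IsSafetyFor rej φ) (T : TransSys S Inp Out) :
    T.Models φ ↔ ∀ x₀ ∈ (M.relax rej).Start T, ∀ x, ReflTransGen ((M.relax rej).Edge T) x₀ x →
      ∀ y, (M.relax rej).Edge T x y → ¬ M.RejEdge rej T x y := by
  constructor
  · intro hT
    -- In the run graph of the original automaton, the sink is not reachable.
    have unreach : ∀ x₀ ∈ M.Start T, ∀ x, ReflTransGen (M.Edge T) x₀ x → x.2 ≠ rej := by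
      intro x₀ h₀ x hx hrej
      have loop : ∀ x : S × Q, x.2 = rej → ∃ y, M.Edge T x y ∧ y.2 = rej := fun x hx =>
        ⟨((T.step x.1 ∅).1, rej), ⟨(∅ : Finset Inp).disjSum (T.step x.1 ∅).2,
          hx ▸ (h.sink _ _).2 rfl, by simp only [Finset.toLeft_disjSum, Finset.toRight_disjSum]⟩,
          rfl⟩
      obtain ⟨y, hxy, hy⟩ := loop x hrej
      obtain ⟨v, hv0, hv, hinf⟩ := exists_path_infinite (D := fun x _ => x.2 = rej)
        (P := fun x => x.2 = rej)
        (fun x hx => (loop x hx).imp' (fun _ => x) fun y hy => ⟨y, .refl, hy.1, hx, hy.2⟩)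
        hx hxy hrej hy
      choose σ hσ using hv
      obtain ⟨k, hk⟩ := hinf.nonempty
      refine (h.not_sat_iff σ).2 ⟨fun i => (v i).2, k, ?_, fun i _ => (hσ i).1, hk⟩
        (hT σ ⟨fun i => (v i).1, ?_, fun i => (hσ i).2.symm⟩)
      · simpa only [hv0] using h₀.2
      · simpa only [hv0] using h₀.1
    rintro x₀ h₀ x hx y - hrej
    -- Up to the first redirected edge, a walk of the relaxed automaton is one of the original.
    have walk : ReflTransGen (M.Edge T) (x₀.1, ↑x₀.2) (x.1, ↑x.2) := by
      clear hrej
      induction hx with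
      | refl => exact .refl
      | tail _ hedge ih =>
        obtain ⟨σ, hσ, hstep⟩ := hedge
        rcases hσ with hσ | hσ
        · exact ih.tail ⟨σ, hσ, hstep⟩
        · exact absurd rfl (unreach (x₀.1, ↑x₀.2) h₀ (_, rej) (ih.tail ⟨σ, hσ.1, hstep⟩))
    obtain ⟨σ, hσ, hstep⟩ := hrej
    exact unreach (x₀.1, ↑x₀.2) h₀ (_, rej) (walk.tail ⟨σ, hσ.1, hstep⟩) rfl
  · rintro hno w ⟨s, hs0, hs⟩
    by_contra hw
    obtain ⟨q, hq, m, p, hwalk, hp⟩ := h.exists_walk_of_not_sat (w := w) (k := 0)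
      (by simpa only [zero_add] using hw)
    have hwalk' := hwalk.lift (p := (M.relax rej).Edge T)
      (fun x : ℕ × {q : Q // q ≠ rej} => (s x.1, x.2)) fun x y hxy =>
        ⟨w x.1, hxy.2, by simpa only [hxy.1] using (hs x.1).symm⟩
    have hr : M.relaxRej rej p (w m) q := ⟨hp, hq⟩
    exact hno (s 0, q) ⟨hs0, hq⟩ _ hwalk' (s (m + 1), q)
      ⟨w m, Or.inr hr, (hs m).symm⟩ ⟨w m, hr, (hs m).symm⟩

/-- A transition system eventually satisfies `G ψ` on all traces iff every infinite path of the
run graph of the relaxed automaton has finitely many redirected edges. Between two redirected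
edges such a path is a rejecting run of the original automaton on the part of the word between
them; conversely, if every suffix of a trace violates `G ψ`, then the finite rejecting runs on
suffixes can be concatenated, because a redirected edge leads to every initial state. -/
theorem models_eventually_iff {ψ : LTL (Inp ⊕ Out)} (h : M.IsSafetyFor rej ψ.globally)
    (T : TransSys S Inp Out) :
    T.Models ψ.globally.eventually ↔
      ∀ v : ℕ → S × {q : Q // q ≠ rej}, v 0 ∈ (M.relax rej).Start T →
        (∀ i, (M.relax rej).Edge T (v i) (v (i + 1))) →
        {i | M.RejEdge rej T (v i) (v (i + 1))}.Finite := by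
  classical
  constructor
  · intro hT v h0 hv
    by_contra hinf
    -- Letters along the path, witnessing a redirected edge wherever there is one.
    have letter : ∀ i, ∃ σ, (M.relax rej).RunGraphEdge T (v i) σ (v (i + 1)) ∧
        (M.RejEdge rej T (v i) (v (i + 1)) → M.relaxRej rej (v i).2 σ (v (i + 1)).2) := by
      intro i
      by_cases hi : M.RejEdge rej T (v i) (v (i + 1))
      · obtain ⟨σ, hσ, hstep⟩ := hi
        exact ⟨σ, ⟨Or.inr hσ, hstep⟩, fun _ => hσ⟩
      · obtain ⟨σ, hσ⟩ := hv i
        exact ⟨σ, hσ, fun h => absurd h hi⟩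
    choose w hw hw' using letter
    obtain ⟨k, hk⟩ := (LTL.sat_eventually _ _).1
      (hT w ⟨fun i => (v i).1, h0.1, fun i => (hw i).2.symm⟩)
    obtain ⟨i, hi, hki⟩ := Set.Infinite.exists_gt hinf k
    obtain ⟨j, hj, hij⟩ := Set.Infinite.exists_gt hinf i
    have hex : ∃ l, M.RejEdge rej T (v (i + 1 + l)) (v (i + 1 + l + 1)) :=
      ⟨j - (i + 1), by rwa [Nat.add_sub_cancel' hij]⟩
    have hspec := Nat.find_spec hex
    have hmin := fun l (hl : l < Nat.find hex) => Nat.find_min hex hl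
    generalize Nat.find hex = l at hspec hmin
    refine (h.not_sat_iff _).2 ⟨fun m => if m ≤ l then ((v (i + 1 + m)).2 : Q) else rej, l + 1,
      ?_, ?_, by simp⟩ (hk.globally_suffix (by omega : k ≤ i + 1))
    · simpa using (hw' i hi).2
    · intro m hm
      rcases (Nat.lt_succ_iff.1 hm).eq_or_lt with rfl | hlt
      · simpa using (hw' _ hspec).1
      · simp only [if_pos hlt.le, if_pos (Nat.succ_le_of_lt hlt)]
        rcases (hw (i + 1 + m)).1 with hσ | hσ
        · exact hσ
        · exact absurd ⟨_, hσ, (hw (i + 1 + m)).2⟩ (hmin m hlt)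
  · rintro hfin w ⟨s, hs0, hs⟩
    rw [LTL.sat_eventually]
    by_contra! hw
    have restart := fun k => h.exists_walk_of_not_sat (hw k)
    obtain ⟨q, hq, m, p, hwalk, hp⟩ := restart 0
    obtain ⟨q', hq', hrest⟩ := restart (m + 1)
    have hr : M.relaxRej rej p (w m) q' := ⟨hp, hq'⟩
    obtain ⟨v, hv0, hv, hinf⟩ := exists_path_infinite
      (D := fun x y : ℕ × {q : Q // q ≠ rej} => M.relaxRej rej x.2 (w x.1) y.2)
      (P := fun x => ∃ (m : ℕ) (p : {q : Q // q ≠ rej}),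
        ReflTransGen (fun x y : ℕ × {q : Q // q ≠ rej} =>
          y.1 = x.1 + 1 ∧ (M.relax rej).trans x.2 (w x.1) y.2) x (m, p) ∧ M.trans p (w m) rej)
      (by
        rintro x ⟨m, p, hwalk, hp⟩
        obtain ⟨q, hq, hrest⟩ := restart (m + 1)
        have hr : M.relaxRej rej p (w m) q := ⟨hp, hq⟩
        exact ⟨(m, p), (m + 1, q), hwalk, ⟨rfl, Or.inr hr⟩, hr, hrest⟩)
      hwalk (z := (m + 1, q')) ⟨rfl, Or.inr hr⟩ hr hrest
    have hpos : ∀ i, (v i).1 = i := fun i => by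
      induction i with
      | zero => rw [hv0]
      | succ i ih => rw [(hv i).1, ih]
    refine hinf ((hfin (fun i => (s i, (v i).2)) ⟨hs0, by rw [hv0]; exact hq⟩
      fun i => ⟨w i, ?_, (hs i).symm⟩).subset fun i hi => ⟨w i, ?_, (hs i).symm⟩)
    · have := (hv i).2
      rwa [hpos] at this
    · rw [Set.mem_ofPred_eq, hpos] at hi
      exact hi

end IsSafetyFor

end Automaton

/-! ### Semantics of propositional formulas and of their clausal form -/

namespace PropForm

variable {V ι : Type*}

/-- The truth of a formula under an assignment to its variables. -/
def Holds (a : V → Bool) : PropForm V → Prop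
  | var v => a v = true
  | tru => True
  | neg f => ¬ Holds a f
  | and f g => Holds a f ∧ Holds a g
  | or f g => Holds a f ∨ Holds a g

@[simp] theorem holds_var (a : V → Bool) (v : V) : (var v).Holds a ↔ a v = true := Iff.rfl

@[simp] theorem holds_tru (a : V → Bool) : tru.Holds a := trivial

@[simp] theorem holds_neg (a : V → Bool) (f : PropForm V) : (neg f).Holds a ↔ ¬ f.Holds a :=
  Iff.rfl

@[simp] theorem holds_and (a : V → Bool) (f g : PropForm V) :
    (and f g).Holds a ↔ f.Holds a ∧ g.Holds a := Iff.rfl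

@[simp] theorem holds_or (a : V → Bool) (f g : PropForm V) :
    (or f g).Holds a ↔ f.Holds a ∨ g.Holds a := Iff.rfl

@[simp] theorem holds_fls (a : V → Bool) : ¬ fls.Holds a := fun h => h trivial

@[simp] theorem holds_imp (a : V → Bool) (f g : PropForm V) :
    (imp f g).Holds a ↔ (f.Holds a → g.Holds a) := by
  simp [imp, imp_iff_not_or]

@[simp] theorem holds_iff (a : V → Bool) (f g : PropForm V) :
    (iff f g).Holds a ↔ (f.Holds a ↔ g.Holds a) := by
  simp [iff, iff_iff_implies_and_implies]

@[simp] theorem holds_bigAnd [Finite ι] (a : V → Bool) (f : ι → PropForm V) :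
    (bigAnd f).Holds a ↔ ∀ i, (f i).Holds a := by
  have key : ∀ l : List ι, ((l.map f).foldr and tru).Holds a ↔ ∀ i ∈ l, (f i).Holds a := by
    intro l
    induction l with
    | nil => simp
    | cons i l ih => simp [ih]
  simp [bigAnd, key]

@[simp] theorem holds_bigOr [Finite ι] (a : V → Bool) (f : ι → PropForm V) :
    (bigOr f).Holds a ↔ ∃ i, (f i).Holds a := by
  have key : ∀ l : List ι, ((l.map f).foldr or fls).Holds a ↔ ∃ i ∈ l, (f i).Holds a := by
    intro l
    induction l with
    | nil => simp
    | cons i l ih => simp [ih]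
  simp [bigOr, key]

/-- The number with binary digits `x (k-1) … x 0`. -/
def binNum (x : ℕ → Bool) : ℕ → ℕ
  | 0 => 0
  | k + 1 => (if x k then 2 ^ k else 0) + binNum x k

theorem binNum_lt (x : ℕ → Bool) (k : ℕ) : binNum x k < 2 ^ k := by
  induction k with
  | zero => simp [binNum]
  | succ k ih =>
    rw [binNum, pow_succ]
    split_ifs <;> omega

theorem binNum_testBit (m k : ℕ) : binNum m.testBit k = m % 2 ^ k := by
  induction k with
  | zero => simp [binNum, Nat.mod_one]
  | succ k ih =>
    rw [binNum, ih, Nat.mod_pow_succ, Nat.testBit_eq_decide_div_mod_eq]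
    rcases Nat.mod_two_eq_zero_or_one (m / 2 ^ k) with h | h <;> simp [h, add_comm]

theorem holds_gt (a : V → Bool) (x y : ℕ → V) (k : ℕ) :
    (gt x y k).Holds a ↔ binNum (a ∘ y) k < binNum (a ∘ x) k := by
  induction k with
  | zero => simp [gt, binNum]
  | succ k ih =>
    have hx := binNum_lt (a ∘ x) k
    have hy := binNum_lt (a ∘ y) k
    simp only [gt, holds_or, holds_and, holds_var, holds_neg, holds_iff, ih, binNum,
      Function.comp_apply]
    by_cases h₁ : a (x k) = true <;> by_cases h₂ : a (y k) = true <;> simp [h₁, h₂] <;> omega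

theorem holds_ge (a : V → Bool) (x y : ℕ → V) (k : ℕ) :
    (ge x y k).Holds a ↔ binNum (a ∘ y) k ≤ binNum (a ∘ x) k := by
  induction k with
  | zero => simp [ge, binNum]
  | succ k ih =>
    have hx := binNum_lt (a ∘ x) k
    have hy := binNum_lt (a ∘ y) k
    simp only [ge, holds_or, holds_and, holds_var, holds_neg, holds_iff, ih, binNum,
      Function.comp_apply]
    by_cases h₁ : a (x k) = true <;> by_cases h₂ : a (y k) = true <;> simp [h₁, h₂] <;> omega

theorem holds_isZero (a : V → Bool) (x : ℕ → V) (k : ℕ) :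
    (isZero x k).Holds a ↔ binNum (a ∘ x) k = 0 := by
  induction k with
  | zero => simp [isZero, binNum]
  | succ k ih => simp [isZero, binNum, ih]

/-- Under an assignment that satisfies the definitional clauses of `f`, the auxiliary variable
that names `f` has the truth value of `f`. -/
theorem aux_iff_holds {α : V ⊕ PropForm V → Bool} (f : PropForm V)
    (h : ∀ c ∈ f.clauses, c.eval α = true) :
    α (.inr f) = true ↔ f.Holds fun v => α (.inl v) := by
  induction f with
  | var v =>
    simp only [clauses, List.forall_mem_cons, Clause.eval, List.any_cons, List.any_nil] at h
    rw [holds_var]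
    rcases h₁ : α (.inr (var v)) <;> rcases h₂ : α (.inl v) <;> simp_all
  | tru => simpa [clauses, Clause.eval] using h
  | neg f ih =>
    simp only [clauses, List.forall_mem_append, List.forall_mem_cons, Clause.eval, List.any_cons,
      List.any_nil] at h
    rw [holds_neg, ← ih h.2]
    rcases h₁ : α (.inr f) <;> rcases h₂ : α (.inr (neg f)) <;> simp_all
  | and f g ihf ihg =>
    simp only [clauses, List.forall_mem_append, List.forall_mem_cons, Clause.eval, List.any_cons,
      List.any_nil] at h
    rw [holds_and, ← ihf h.1.2, ← ihg h.2]
    rcases h₁ : α (.inr f) <;> rcases h₂ : α (.inr g) <;>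
      rcases h₃ : α (.inr (and f g)) <;> simp_all
  | or f g ihf ihg =>
    simp only [clauses, List.forall_mem_append, List.forall_mem_cons, Clause.eval, List.any_cons,
      List.any_nil] at h
    rw [holds_or, ← ihf h.1.2, ← ihg h.2]
    rcases h₁ : α (.inr f) <;> rcases h₂ : α (.inr g) <;>
      rcases h₃ : α (.inr (or f g)) <;> simp_all

open scoped Classical in
/-- The extension of an assignment to the auxiliary variables by the truth values of the
formulas that they name. -/
noncomputable def extend (a : V → Bool) : V ⊕ PropForm V → Bool :=
  Sum.elim a fun f => decide (f.Holds a)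

theorem eval_clauses_extend (a : V → Bool) (f : PropForm V) :
    ∀ c ∈ f.clauses, c.eval (extend a) = true := by
  induction f with
  | var v =>
    rcases h : a v <;> simp [clauses, Clause.eval, extend, h]
  | tru => simp [clauses, Clause.eval, extend]
  | neg f ih =>
    rw [clauses, List.forall_mem_append]
    refine ⟨?_, ih⟩
    simp only [List.forall_mem_cons, Clause.eval, List.any_cons, List.any_nil, extend, Sum.elim_inr]
    by_cases hf : f.Holds a <;> simp [hf]
  | and f g ihf ihg =>
    rw [clauses, List.forall_mem_append, List.forall_mem_append]
    refine ⟨⟨?_, ihf⟩, ihg⟩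
    simp only [List.forall_mem_cons, Clause.eval, List.any_cons, List.any_nil, extend, Sum.elim_inr]
    by_cases hf : f.Holds a <;> by_cases hg : g.Holds a <;> simp [hf, hg]
  | or f g ihf ihg =>
    rw [clauses, List.forall_mem_append, List.forall_mem_append]
    refine ⟨⟨?_, ihf⟩, ihg⟩
    simp only [List.forall_mem_cons, Clause.eval, List.any_cons, List.any_nil, extend, Sum.elim_inr]
    by_cases hf : f.Holds a <;> by_cases hg : g.Holds a <;> simp [hf, hg]

end PropForm

/-! ### MaxSAT instances of constraint systems -/

namespace MaxSAT

variable {V : Type*}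

theorem weight_le (P : MaxSAT V) (α : V → Bool) :
    P.weight α ≤ (P.soft.map fun c => (c.2 : ℕ)).sum := by
  refine List.sum_le_sum fun c _ => ?_
  split_ifs <;> simp

theorem Satisfiable.exists_isOptimal {P : MaxSAT V} (h : P.Satisfiable) :
    ∃ α, P.IsOptimal α := by
  obtain ⟨α, hα⟩ := h
  have hbdd : BddAbove {w | ∃ β, P.IsSat β ∧ P.weight β = w} :=
    ⟨_, by rintro _ ⟨β, _, rfl⟩; exact P.weight_le β⟩
  obtain ⟨β, hβ, hw⟩ := Nat.sSup_mem (s := {w | ∃ β, P.IsSat β ∧ P.weight β = w})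
    ⟨_, α, hα, rfl⟩ hbdd
  exact ⟨β, hβ, fun γ hγ => hw ▸ le_csSup hbdd ⟨γ, hγ, rfl⟩⟩

end MaxSAT

section ToMaxSAT

open PropForm

variable {V : Type*} {hard : PropForm V} {soft : List (PropForm V × ℕ+)}

theorem MaxSAT.IsSat.holds_hard {α : V ⊕ PropForm V → Bool} (h : (toMaxSAT hard soft).IsSat α) :
    hard.Holds fun v => α (.inl v) := by
  simp only [MaxSAT.IsSat, toMaxSAT, List.forall_mem_cons, List.forall_mem_append] at h
  rw [← aux_iff_holds hard h.2.1]
  simpa [Clause.eval] using h.1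

theorem isSat_extend {a : V → Bool} (h : hard.Holds a) :
    (toMaxSAT hard soft).IsSat (extend a) := by
  simp only [MaxSAT.IsSat, toMaxSAT, List.forall_mem_cons, List.forall_mem_append]
  refine ⟨by simpa [Clause.eval, extend] using h, eval_clauses_extend a hard, fun c hc => ?_⟩
  obtain ⟨s, _, hs⟩ := List.mem_flatMap.1 hc
  exact eval_clauses_extend a s.1 c hs

open scoped Classical in
/-- The weight of a satisfying assignment is that of the soft constraints that hold under it. -/
theorem MaxSAT.IsSat.weight_eq {α : V ⊕ PropForm V → Bool} (h : (toMaxSAT hard soft).IsSat α) :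
    (toMaxSAT hard soft).weight α =
      (soft.map fun c => if c.1.Holds fun v => α (.inl v) then (c.2 : ℕ) else 0).sum := by
  simp only [MaxSAT.IsSat, toMaxSAT, List.forall_mem_cons, List.forall_mem_append] at h
  rw [MaxSAT.weight, toMaxSAT, List.map_map]
  congr 1
  refine List.map_congr_left fun c hc => ?_
  have := aux_iff_holds c.1 fun d hd => h.2.2 d (List.mem_flatMap.2 ⟨c, hc, hd⟩)
  simp [Clause.eval, ← this]

end ToMaxSAT

/-! ### Meaning of the constraints -/

namespace PropForm

variable {V : Type*}

theorem holds_ite (a : V → Bool) (c : Prop) [Decidable c] (f g : PropForm V) :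
    (if c then f else g).Holds a ↔ (c ∧ f.Holds a) ∨ (¬ c ∧ g.Holds a) := by
  split_ifs with h <;> simp [h]

end PropForm

theorem TransSys.Models.eventually {S Inp Out : Type*} {T : TransSys S Inp Out}
    {φ : LTL (Inp ⊕ Out)} (h : T.Models φ) : T.Models φ.eventually := fun w hw =>
  (LTL.sat_eventually _ _).2 ⟨0, by simpa only [zero_add] using h w hw⟩

namespace Enc

open PropForm Automaton

variable {b n : ℕ} {Inp Out Q : Type*} {Q₁ Q₂ : Fin n → Type*}

/-- The variables `τ_{s,σI,s'}` and `o_{s,σI}` describe the transition function of `T`. -/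
structure Reads (a : EncVar b n Inp Out Q Q₁ Q₂ → Bool) (T : TransSys (Fin b) Inp Out) :
    Prop where
  trans : ∀ s σI s', a (.trans s σI s') = true ↔ (T.step s σI).1 = s'
  out : ∀ s σI o, a (.out s σI o) = true ↔ o ∈ (T.step s σI).2

variable {a : EncVar b n Inp Out Q Q₁ Q₂ → Bool} {T : TransSys (Fin b) Inp Out}

theorem holds_cTau [Finite Inp] :
    (cTau : PropForm (EncVar b n Inp Out Q Q₁ Q₂)).Holds a ↔
      ∀ s σI, ∃! s', a (.trans s σI s') = true := by
  simp only [cTau, holds_bigAnd, holds_and, holds_bigOr, holds_var, holds_ite,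
    holds_tru, and_true, holds_or, holds_neg]
  refine forall₂_congr fun s σI => ⟨?_, ?_⟩
  · rintro ⟨⟨s', hs'⟩, huniq⟩
    refine ⟨s', hs', fun s'' hs'' => ?_⟩
    have := huniq s'' s'
    tauto
  · rintro ⟨s', hs', huniq⟩
    refine ⟨⟨s', hs'⟩, fun t t' => ?_⟩
    have ht := huniq t
    have ht' := huniq t'
    by_cases htt : t = t'
    · exact Or.inl htt
    · refine Or.inr ⟨htt, ?_⟩
      by_contra! h
      exact htt ((ht h.1).trans (ht' h.2).symm)

theorem Reads.holds_cTau [Finite Inp] (h : Reads a T) :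
    (cTau : PropForm (EncVar b n Inp Out Q Q₁ Q₂)).Holds a :=
  Enc.holds_cTau.2 fun s σI =>
    ⟨(T.step s σI).1, (h.trans _ _ _).2 rfl, fun _ hs => ((h.trans _ _ _).1 hs).symm⟩

theorem exists_reads [Finite Inp] [Finite Out]
    (h : (cTau : PropForm (EncVar b n Inp Out Q Q₁ Q₂)).Holds a) (s₀ : Fin b) :
    ∃ T : TransSys (Fin b) Inp Out, T.init = s₀ ∧ Reads a T := by
  choose succ hsucc huniq using Enc.holds_cTau.1 h
  refine ⟨⟨s₀, fun s σI =>
    (succ s σI, (Set.toFinite {o | a (.out s σI o) = true}).toFinset)⟩, rfl, ?_, ?_⟩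
  · exact fun s σI s' => ⟨fun hs => (huniq s σI s' hs).symm, fun hs => hs ▸ hsucc s σI⟩
  · simp

theorem Reads.holds_letterIn [Finite Out] (h : Reads a T) (L : Finset (Inp ⊕ Out) → Prop)
    (s : Fin b) (σI : Finset Inp) :
    (letterIn L s σI : PropForm (EncVar b n Inp Out Q Q₁ Q₂)).Holds a ↔
      L (σI.disjSum (T.step s σI).2) := by
  have key : ∀ σO : Finset Out,
      (∀ o, o ∈ σO ∧ a (.out s σI o) = true ∨ o ∉ σO ∧ ¬ a (.out s σI o) = true) ↔
        σO = (T.step s σI).2 := by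
    intro σO
    rw [Finset.ext_iff]
    refine forall_congr' fun o => ?_
    rw [h.out]
    tauto
  simp only [letterIn, holds_bigOr, holds_ite, holds_bigAnd, holds_var, holds_neg, holds_fls,
    and_false, or_false, key, exists_eq_right]

theorem Reads.holds_annotation [Finite Inp] [Finite Out] {P : Type*} [Finite P] (h : Reads a T)
    (M : Automaton P (Finset (Inp ⊕ Out))) (vB : Fin b → P → EncVar b n Inp Out Q Q₁ Q₂)
    (cmp : Fin b → P → Finset Inp → Fin b → P → PropForm (EncVar b n Inp Out Q Q₁ Q₂)) :
    (annotation M T.init vB cmp).Holds a ↔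
      (∀ p ∈ M.init, a (vB T.init p) = true) ∧
        ∀ s p σI s' p', a (vB s p) = true → M.trans p (σI.disjSum (T.step s σI).2) p' →
          (T.step s σI).1 = s' → a (vB s' p') = true ∧ (cmp s p σI s' p').Holds a := by
  simp only [annotation, holds_and, holds_bigAnd, holds_imp, holds_var, h.holds_letterIn, h.trans,
    and_imp, holds_ite, holds_tru, and_true]
  refine and_congr (forall_congr' fun p => ?_) Iff.rfl
  tauto

/-- A letter on an edge of a run graph is determined by its input part. -/
theorem exists_letter_iff {S : Type*} (T : TransSys S Inp Out) (L : Finset (Inp ⊕ Out) → Prop)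
    (s s' : S) :
    (∃ σ, L σ ∧ T.step s σ.toLeft = (s', σ.toRight)) ↔
      ∃ σI, L (σI.disjSum (T.step s σI).2) ∧ (T.step s σI).1 = s' := by
  constructor
  · rintro ⟨σ, hL, hstep⟩
    refine ⟨σ.toLeft, ?_, by rw [hstep]⟩
    rwa [hstep, Finset.toLeft_disjSum_toRight]
  · rintro ⟨σI, hL, rfl⟩
    exact ⟨_, hL, by rw [Finset.toLeft_disjSum, Finset.toRight_disjSum]⟩

/-- The constraints on the annotation for a co-Büchi automaton say that it is a valid annotation
of the run graph, with progress when a rejecting state is entered. -/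
theorem Reads.holds_coBuchi [Finite Inp] [Finite Out] {P : Type*} [Finite P] (h : Reads a T)
    (M : Automaton P (Finset (Inp ⊕ Out))) (vB : Fin b → P → EncVar b n Inp Out Q Q₁ Q₂)
    (vN : Fin b → P → ℕ → EncVar b n Inp Out Q Q₁ Q₂) :
    (annotation M T.init vB (coBuchiCmp M vN)).Holds a ↔
      IsAnnotation (M.Edge T) (fun _ y => y.2 ∈ M.F) (M.Start T) (fun x => a (vB x.1 x.2) = true)
        (fun x => binNum (a ∘ vN x.1 x.2) (bits b P)) := by
  rw [h.holds_annotation]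
  simp only [coBuchiCmp, holds_ite, holds_gt, holds_ge]
  constructor
  · rintro ⟨hinit, hstep⟩
    refine ⟨fun x hx => hx.1 ▸ hinit _ hx.2, fun x y hxy hx => ?_, fun x y hxy hx => ?_,
      fun x y hxy hD hx => ?_⟩ <;>
    obtain ⟨σI, hσ, hs⟩ := (exists_letter_iff T (fun σ => M.trans x.2 σ y.2) x.1 y.1).1 hxy <;>
    obtain ⟨hB, hcmp⟩ := hstep x.1 x.2 σI y.1 y.2 hx hσ hs
    · exact hB
    · exact hcmp.elim (fun h => h.2.le) fun h => h.2
    · exact hcmp.elim (fun h => h.2) fun h => absurd hD h.1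
  · intro hann
    refine ⟨fun p hp => hann.init (T.init, p) ⟨rfl, hp⟩, fun s p σI s' p' hB hσ hs => ?_⟩
    have hE : M.Edge T (s, p) (s', p') :=
      (exists_letter_iff T (fun σ => M.trans p σ p') s s').2 ⟨σI, hσ, hs⟩
    refine ⟨hann.closed _ _ hE hB, ?_⟩
    by_cases hF : p' ∈ M.F
    · exact Or.inl ⟨hF, hann.lt _ _ hE hF hB⟩
    · exact Or.inr ⟨hF, hann.le _ _ hE hB⟩

/-- The constraints on the annotation for a relaxed automaton say that it is a valid annotation
of the run graph, with progress along the redirected edges. -/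
theorem Reads.holds_relax [Finite Inp] [Finite Out] {P : Type*} [Finite P] (h : Reads a T)
    (M : Automaton P (Finset (Inp ⊕ Out))) (rej : P)
    (vB : Fin b → {p : P // p ≠ rej} → EncVar b n Inp Out Q Q₁ Q₂)
    (vN : Fin b → {p : P // p ≠ rej} → ℕ → EncVar b n Inp Out Q Q₁ Q₂) :
    (annotation (M.relax rej) T.init vB (relaxCmp (M.relaxRej rej) vN)).Holds a ↔
      IsAnnotation ((M.relax rej).Edge T) (M.RejEdge rej T) ((M.relax rej).Start T)
        (fun x => a (vB x.1 x.2) = true)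
        (fun x => binNum (a ∘ vN x.1 x.2) (bits b {p : P // p ≠ rej})) := by
  rw [h.holds_annotation]
  simp only [relaxCmp, holds_and, holds_imp, holds_neg, h.holds_letterIn, holds_gt, holds_ge]
  constructor
  · rintro ⟨hinit, hstep⟩
    refine ⟨fun x hx => hx.1 ▸ hinit _ hx.2, fun x y hxy hx => ?_, fun x y hxy hx => ?_,
      fun x y _ hD hx => ?_⟩
    · obtain ⟨σI, hσ, hs⟩ :=
        (exists_letter_iff T (fun σ => (M.relax rej).trans x.2 σ y.2) x.1 y.1).1 hxy
      exact (hstep x.1 x.2 σI y.1 y.2 hx hσ hs).1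
    · obtain ⟨σI, hσ, hs⟩ :=
        (exists_letter_iff T (fun σ => (M.relax rej).trans x.2 σ y.2) x.1 y.1).1 hxy
      obtain ⟨-, hgt, hge⟩ := hstep x.1 x.2 σI y.1 y.2 hx hσ hs
      by_cases hr : M.relaxRej rej x.2 (σI.disjSum (T.step x.1 σI).2) y.2
      · exact (hgt hr).le
      · exact hge hr
    · obtain ⟨σI, hσ, hs⟩ :=
        (exists_letter_iff T (fun σ => M.relaxRej rej x.2 σ y.2) x.1 y.1).1 hD
      exact (hstep x.1 x.2 σI y.1 y.2 hx (Or.inr hσ) hs).2.1 hσ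
  · intro hann
    refine ⟨fun p hp => hann.init (T.init, p) ⟨rfl, hp⟩, fun s p σI s' p' hB hσ hs => ?_⟩
    have hE : (M.relax rej).Edge T (s, p) (s', p') :=
      (exists_letter_iff T (fun σ => (M.relax rej).trans p σ p') s s').2 ⟨σI, hσ, hs⟩
    refine ⟨hann.closed _ _ hE hB, fun hr => ?_, fun _ => hann.le _ _ hE hB⟩
    exact hann.lt _ _ hE ((exists_letter_iff T (fun σ => M.relaxRej rej p σ p') s s').2
      ⟨σI, hr, hs⟩) hB

/-! ### Correctness of the constraints -/

theorem exists_isAnnotation_of_models {P : Type*} [Finite P]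
    {M : Automaton P (Finset (Inp ⊕ Out))} {φ : LTL (Inp ⊕ Out)} (hM : M.IsCoBuchiFor φ) :
    ∃ B N, (T.Models φ → IsAnnotation (M.Edge T) (fun _ y => y.2 ∈ M.F) (M.Start T) B N) ∧
      ∀ x, N x ≤ Nat.card (Fin b × P) := by
  by_cases hT : T.Models φ
  · rw [← hM, coBuchiAcceptsTS_iff] at hT
    obtain ⟨B, N, hann, hle⟩ := exists_isAnnotation (D := fun _ y : Fin b × P => y.2 ∈ M.F) hT
    exact ⟨B, N, fun _ => hann, hle⟩
  · exact ⟨fun _ => False, fun _ => 0, fun h => absurd h hT, by simp⟩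

/-- If `G ψ` holds, then the annotation of the relaxed automaton can be chosen to be `0`. -/
theorem exists_isAnnotation_relax {P : Type*} [Finite P] {M : Automaton P (Finset (Inp ⊕ Out))}
    {rej : P} {ψ : LTL (Inp ⊕ Out)} (hM : M.IsSafetyFor rej ψ.globally) :
    ∃ B N, (T.Models ψ.globally.eventually →
        IsAnnotation ((M.relax rej).Edge T) (M.RejEdge rej T) ((M.relax rej).Start T) B N) ∧
      (T.Models ψ.globally → ∀ x, N x = 0) ∧
      ∀ x, N x ≤ Nat.card (Fin b × {p : P // p ≠ rej}) := by
  by_cases hG : T.Models ψ.globally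
  · obtain ⟨B, hann⟩ := exists_isAnnotation_zero.2 ((hM.models_iff T).1 hG)
    exact ⟨B, _, fun _ => hann, fun _ _ => rfl, by simp⟩
  by_cases hFG : T.Models ψ.globally.eventually
  · obtain ⟨B, N, hann, hle⟩ := exists_isAnnotation ((hM.models_eventually_iff T).1 hFG)
    exact ⟨B, N, fun _ => hann, fun h => absurd h hG, hle⟩
  · exact ⟨fun _ => False, fun _ => 0, fun h => absurd h hFG, fun _ _ => rfl, by simp⟩

section Correctness

variable [Finite Inp] [Finite Out] {R : Fin n → Type*} [∀ j, Finite (R j)]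

theorem Reads.models_of_coBuchi {P : Type*} [Finite P] (h : Reads a T)
    {M : Automaton P (Finset (Inp ⊕ Out))} {φ : LTL (Inp ⊕ Out)} (hM : M.IsCoBuchiFor φ)
    {vB : Fin b → P → EncVar b n Inp Out Q Q₁ Q₂}
    {vN : Fin b → P → ℕ → EncVar b n Inp Out Q Q₁ Q₂}
    (ha : (annotation M T.init vB (coBuchiCmp M vN)).Holds a) : T.Models φ := by
  rw [← hM, coBuchiAcceptsTS_iff]
  exact fun v h0 hv => ((h.holds_coBuchi M vB vN).1 ha).finite_progress h0 hv

variable {B : ∀ j, Automaton (R j) (Finset (Inp ⊕ Out))} {rej : ∀ j, R j}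

theorem Reads.models_of_cPi {a : EncVar b n Inp Out Q (fun j => {q : R j // q ≠ rej j}) Q₂ → Bool}
    (h : Reads a T) {j : Fin n} {ψ : LTL (Inp ⊕ Out)}
    (hB : (B j).IsSafetyFor (rej j) ψ.globally) (ha : (cPi B rej T.init j).Holds a) :
    T.Models ψ.globally.eventually := by
  rw [hB.models_eventually_iff]
  exact fun v h0 hv => ((h.holds_relax _ _ _ _).1 ha).finite_progress h0 hv

theorem Reads.models_of_softG
    {a : EncVar b n Inp Out Q (fun j => {q : R j // q ≠ rej j}) Q₂ → Bool}
    (h : Reads a T) {j : Fin n} {φ : LTL (Inp ⊕ Out)}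
    (hB : (B j).IsSafetyFor (rej j) φ) (ha : (softG B rej T.init j).Holds a) :
    T.Models φ := by
  rw [hB.models_iff, ← exists_isAnnotation_zero]
  simp only [softG, holds_and, holds_bigAnd, holds_isZero] at ha
  have hann := (h.holds_relax _ _ _ _).1 ha.1
  simp only [ha.2] at hann
  exact ⟨_, hann⟩

end Correctness

open scoped Classical in
/-- The assignment that describes `T` and given annotations for all the automata. -/
noncomputable def assign (T : TransSys (Fin b) Inp Out)
    (B : Fin b × Q → Prop) (N : Fin b × Q → ℕ)
    (B₁ : ∀ j, Fin b × Q₁ j → Prop) (N₁ : ∀ j, Fin b × Q₁ j → ℕ)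
    (B₂ : ∀ j, Fin b × Q₂ j → Prop) (N₂ : ∀ j, Fin b × Q₂ j → ℕ) :
    EncVar b n Inp Out Q Q₁ Q₂ → Bool
  | .trans s σI s' => decide ((T.step s σI).1 = s')
  | .out s σI o => decide (o ∈ (T.step s σI).2)
  | .lamB s q => decide (B (s, q))
  | .lamN s q i => (N (s, q)).testBit i
  | .piB j s q => decide (B₁ j (s, q))
  | .piN j s q i => (N₁ j (s, q)).testBit i
  | .hatB j s q => decide (B₂ j (s, q))
  | .hatN j s q i => (N₂ j (s, q)).testBit i

theorem reads_assign (T : TransSys (Fin b) Inp Out)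
    (B : Fin b × Q → Prop) (N : Fin b × Q → ℕ)
    (B₁ : ∀ j, Fin b × Q₁ j → Prop) (N₁ : ∀ j, Fin b × Q₁ j → ℕ)
    (B₂ : ∀ j, Fin b × Q₂ j → Prop) (N₂ : ∀ j, Fin b × Q₂ j → ℕ) :
    Reads (assign T B N B₁ N₁ B₂ N₂) T :=
  ⟨fun _ _ _ => by simp [assign], fun _ _ _ => by simp [assign]⟩

/-- The available bits suffice for the numbers up to the size of the run graph. -/
theorem binNum_testBit_bits {P : Type*} {m : ℕ} (h : m ≤ Nat.card (Fin b × P)) :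
    binNum m.testBit (bits b P) = m := by
  rw [binNum_testBit, Nat.mod_eq_of_lt]
  rw [Nat.card_prod, Nat.card_fin] at h
  exact h.trans_lt (Nat.lt_size_self _)

/-- Every transition system is described by an assignment under which each of the constraints
holds that can hold for this transition system. -/
theorem exists_assignment [Finite Inp] [Finite Out] [Finite Q] {R : Fin n → Type*}
    [∀ j, Finite (R j)] [∀ j, Finite (Q₂ j)] {φ : LTL (Inp ⊕ Out)}
    {ψ : Fin n → LTL (Inp ⊕ Out)} {A : Automaton Q (Finset (Inp ⊕ Out))} (hA : A.IsCoBuchiFor φ)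
    {B : ∀ j, Automaton (R j) (Finset (Inp ⊕ Out))} {rej : ∀ j, R j}
    (hB : ∀ j, (B j).IsSafetyFor (rej j) (ψ j).globally)
    {A' : ∀ j, Automaton (Q₂ j) (Finset (Inp ⊕ Out))}
    (hA' : ∀ j, (A' j).IsCoBuchiFor (ψ j).eventually.globally)
    (T : TransSys (Fin b) Inp Out) :
    ∃ a : EncVar b n Inp Out Q (fun j => {q : R j // q ≠ rej j}) Q₂ → Bool, Reads a T ∧
      (T.Models φ → (cLam A T.init).Holds a) ∧
      ∀ j, (T.Models (ψ j).globally → (softG B rej T.init j).Holds a) ∧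
        (T.Models (ψ j).globally.eventually → (cPi B rej T.init j).Holds a) ∧
        (T.Models (ψ j).eventually.globally → (cHat A' T.init j).Holds a) := by
  obtain ⟨B₀, N₀, h₀, hle₀⟩ := exists_isAnnotation_of_models (T := T) hA
  choose B₁ N₁ h₁ hz₁ hle₁ using fun j => exists_isAnnotation_relax (T := T) (hB j)
  choose B₂ N₂ h₂ hle₂ using fun j => exists_isAnnotation_of_models (T := T) (hA' j)
  have hreads := reads_assign T B₀ N₀ B₁ N₁ B₂ N₂
  have hnum₁ : ∀ j s q, binNum (assign T B₀ N₀ B₁ N₁ B₂ N₂ ∘ fun i => .piN j s q i)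
      (bits b {q : R j // q ≠ rej j}) = N₁ j (s, q) := fun j s q =>
    binNum_testBit_bits (hle₁ j (s, q))
  have hPi : ∀ j, T.Models (ψ j).globally.eventually →
      (cPi B rej T.init j).Holds (assign T B₀ N₀ B₁ N₁ B₂ N₂) := by
    intro j hT
    refine (hreads.holds_relax _ _ _ _).2 ?_
    convert h₁ j hT using 1
    · exact funext fun x => by simp [assign]
    · exact funext fun x => hnum₁ j x.1 x.2
  refine ⟨_, hreads, fun hT => ?_, fun j => ⟨fun hT => ⟨hPi j hT.eventually, ?_⟩, hPi j,
    fun hT => ?_⟩⟩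
  · refine (hreads.holds_coBuchi _ _ _).2 ?_
    convert h₀ hT using 1
    · exact funext fun x => by simp [assign]
    · exact funext fun x => binNum_testBit_bits (hle₀ x)
  · simp only [holds_bigAnd, holds_isZero]
    intro s q
    exact (hnum₁ j s q).trans (hz₁ j hT _)
  · refine (hreads.holds_coBuchi _ _ _).2 ?_
    convert h₂ j hT using 1
    · exact funext fun x => by simp [assign]
    · exact funext fun x => binNum_testBit_bits (hle₂ j x)

end Enc

/-! ### Values of transition systems -/

namespace TransSys

variable {S Inp Out : Type*} {n : ℕ}

open scoped Classical in
theorem value_fst (T : TransSys S Inp Out) (ψ : LTL (Inp ⊕ Out)) :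
    (T.value ψ).1 = if T.Models ψ.globally.eventually ∨ T.Models ψ.eventually.globally
      then 1 else 0 := by
  have := Models.eventually (T := T) (φ := ψ.globally)
  unfold value
  split_ifs <;> tauto

open scoped Classical in
theorem value_snd_fst (T : TransSys S Inp Out) (ψ : LTL (Inp ⊕ Out)) :
    (T.value ψ).2.1 = if T.Models ψ.globally.eventually then 1 else 0 := by
  have := Models.eventually (T := T) (φ := ψ.globally)
  unfold value
  split_ifs <;> tauto

open scoped Classical in
theorem value_snd_snd (T : TransSys S Inp Out) (ψ : LTL (Inp ⊕ Out)) :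
    (T.value ψ).2.2 = if T.Models ψ.globally then 1 else 0 := by
  unfold value
  split_ifs <;> rfl

theorem value_nested (T : TransSys S Inp Out) (ψ : LTL (Inp ⊕ Out)) :
    (T.value ψ).1 ≤ 1 ∧ (T.value ψ).2.1 ≤ (T.value ψ).1 ∧ (T.value ψ).2.2 ≤ (T.value ψ).2.1 := by
  unfold value
  split_ifs <;> simp

/-- The value of a conjunction as a single number: the total weight of the soft constraints that
can be satisfied along with `T`. -/
noncomputable def score (T : TransSys S Inp Out) (ψ : Fin n → LTL (Inp ⊕ Out)) : ℕ :=
  ∑ j, ((T.value (ψ j)).2.2 + n * (T.value (ψ j)).2.1 + n ^ 2 * (T.value (ψ j)).1)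

/-- For triples of numbers `≤ n` whose entries decrease from left to right, the weights `n²`, `n`,
`1` respect the lexicographic order. In general they would not, since `(1, 0, 0)` and `(0, n, 0)` have
the same weight; but if an entry of one triple is smaller than `n`, so are those to the right
of it. -/
theorem toLex_le_of_weight_le {n x₁ x₂ x₃ y₁ y₂ y₃ : ℕ} (hx₁ : x₁ ≤ n) (hx₂ : x₂ ≤ x₁)
    (hy₁ : y₁ ≤ n) (hy₂ : y₂ ≤ y₁) (hy₃ : y₃ ≤ y₂)
    (h : x₃ + n * x₂ + n ^ 2 * x₁ ≤ y₃ + n * y₂ + n ^ 2 * y₁) :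
    (toLex (x₁, toLex (x₂, x₃)) : ℕ ×ₗ ℕ ×ₗ ℕ) ≤ toLex (y₁, toLex (y₂, y₃)) := by
  rw [Prod.Lex.toLex_le_toLex, Prod.Lex.toLex_le_toLex]
  rcases lt_trichotomy x₁ y₁ with h₁ | rfl | h₁
  · exact Or.inl h₁
  · refine Or.inr ⟨rfl, ?_⟩
    rcases lt_trichotomy x₂ y₂ with h₂ | rfl | h₂
    · exact Or.inl h₂
    · exact Or.inr ⟨rfl, by omega⟩
    · have : n * (y₂ + 1) ≤ n * x₂ := Nat.mul_le_mul_left _ h₂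
      rw [mul_add] at this
      omega
  · have hxy : n ^ 2 * (y₁ + 1) ≤ n ^ 2 * x₁ := Nat.mul_le_mul_left _ h₁
    have hmul : n * (y₂ + 1) ≤ n * n := Nat.mul_le_mul_left _ (by omega)
    rw [mul_add] at hxy hmul
    rw [← sq] at hmul
    omega

theorem valueConj_le_of_score_le {S' : Type*} {T : TransSys S Inp Out}
    {T' : TransSys S' Inp Out} {ψ : Fin n → LTL (Inp ⊕ Out)} (h : T.score ψ ≤ T'.score ψ) :
    T.valueConj ψ ≤ T'.valueConj ψ := by
  simp only [score, Finset.sum_add_distrib, ← Finset.mul_sum] at h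
  exact toLex_le_of_weight_le
    ((Finset.sum_le_sum fun j _ => (T.value_nested (ψ j)).1).trans_eq (by simp))
    (Finset.sum_le_sum fun j _ => (T.value_nested (ψ j)).2.1)
    ((Finset.sum_le_sum fun j _ => (T'.value_nested (ψ j)).1).trans_eq (by simp))
    (Finset.sum_le_sum fun j _ => (T'.value_nested (ψ j)).2.1)
    (Finset.sum_le_sum fun j _ => (T'.value_nested (ψ j)).2.2) h

/-- A transition system with at most `b` states can be simulated by one with the state set
`Fin b`, which has copies of some states if `b` is larger. -/
theorem exists_fin_isTrace_iff [Finite S] {b : ℕ} (T : TransSys S Inp Out)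
    (hcard : Nat.card S ≤ b) (s₀ : Fin b) :
    ∃ T' : TransSys (Fin b) Inp Out, T'.init = s₀ ∧ ∀ w, T'.IsTrace w ↔ T.IsTrace w := by
  classical
  have : Nonempty S := ⟨T.init⟩
  -- An embedding that maps the initial state to `s₀`.
  obtain ⟨e, he, he₀⟩ : ∃ e : S → Fin b, Function.Injective e ∧ e T.init = s₀ :=
    let e₀ : S → Fin b := Fin.castLE hcard ∘ Finite.equivFin S
    ⟨Equiv.swap (e₀ T.init) s₀ ∘ e₀, (Equiv.injective _).comp
      ((Fin.castLE_injective hcard).comp (Finite.equivFin S).injective), by simp⟩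
  have hinv : ∀ s, Function.invFun e (e s) = s := Function.leftInverse_invFun he
  refine ⟨⟨s₀, fun x σ => (e (T.step (Function.invFun e x) σ).1,
    (T.step (Function.invFun e x) σ).2)⟩, rfl, fun w => ⟨?_, ?_⟩⟩
  · rintro ⟨s, hs0, hs⟩
    refine ⟨fun i => Function.invFun e (s i), ?_, fun i => ?_⟩
    · simp only [hs0, ← he₀, hinv]
    · have h := hs i
      simp only [Prod.mk.injEq] at h
      simp only [h.1, h.2, hinv]
  · rintro ⟨s, hs0, hs⟩
    refine ⟨fun i => e (s i), by simp only [hs0, he₀], fun i => ?_⟩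
    simp only [hinv, ← hs i]

theorem models_congr {S' : Type*} {T : TransSys S Inp Out} {T' : TransSys S' Inp Out}
    (h : ∀ w, T'.IsTrace w ↔ T.IsTrace w) (φ : LTL (Inp ⊕ Out)) :
    T'.Models φ ↔ T.Models φ := by
  simp only [Models, h]

theorem score_congr {S' : Type*} {T : TransSys S Inp Out} {T' : TransSys S' Inp Out}
    (h : ∀ w, T'.IsTrace w ↔ T.IsTrace w) (ψ : Fin n → LTL (Inp ⊕ Out)) :
    T'.score ψ = T.score ψ := by
  have hM : T'.Models = T.Models := funext fun φ => propext (models_congr h φ)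
  simp only [score, value_fst, value_snd_fst, value_snd_snd]
  rw [hM]

end TransSys

/-! ### Optimal assignments -/

namespace Enc

open PropForm

variable {b n : ℕ} {Inp Out Q : Type*} [Finite Inp] [Finite Out] [Finite Q]
  {R Q' : Fin n → Type*} [∀ j, Finite (R j)] [∀ j, Finite (Q' j)]
  {φ : LTL (Inp ⊕ Out)} {ψ : Fin n → LTL (Inp ⊕ Out)}
  {A : Automaton Q (Finset (Inp ⊕ Out))}
  {B : ∀ j, Automaton (R j) (Finset (Inp ⊕ Out))} {rej : ∀ j, R j}
  {A' : ∀ j, Automaton (Q' j) (Finset (Inp ⊕ Out))} {s₀ : Fin b}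

theorem ite_one_zero_le {p q : Prop} [Decidable p] [Decidable q] (h : p → q) :
    (if p then 1 else 0 : ℕ) ≤ if q then 1 else 0 := by
  split_ifs <;> simp_all

open scoped Classical in
theorem weight_constraintSystem
    {α : EncVar b n Inp Out Q (fun j => {q : R j // q ≠ rej j}) Q' ⊕
      PropForm (EncVar b n Inp Out Q (fun j => {q : R j // q ≠ rej j}) Q') → Bool}
    (h : (constraintSystem A B rej A' s₀).IsSat α) :
    (constraintSystem A B rej A' s₀).weight α =
      ∑ j, ((if (softG B rej s₀ j).Holds fun v => α (.inl v) then 1 else 0) +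
        n * (if (cPi B rej s₀ j).Holds fun v => α (.inl v) then 1 else 0) +
        n ^ 2 * (if ((cPi B rej s₀ j).Holds fun v => α (.inl v)) ∨
          (cHat A' s₀ j).Holds fun v => α (.inl v) then 1 else 0)) := by
  rw [constraintSystem] at h ⊢
  rw [h.weight_eq, List.map_flatMap, List.flatMap, List.sum_flatten, List.map_map,
    Fin.sum_univ_def]
  congr 1
  refine List.map_congr_left fun j _ => ?_
  have hsq : ((⟨n, j.pos⟩ ^ 2 : ℕ+) : ℕ) = n ^ 2 := PNat.pow_coe _ _
  simp [add_assoc, hsq]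

/-- A satisfying assignment describes a transition system that satisfies the hard specification;
the weight of the assignment is at most the score of the transition system. -/
theorem exists_transSys_of_isSat (hA : A.IsCoBuchiFor φ)
    (hB : ∀ j, (B j).IsSafetyFor (rej j) (ψ j).globally)
    (hA' : ∀ j, (A' j).IsCoBuchiFor (ψ j).eventually.globally)
    {α : EncVar b n Inp Out Q (fun j => {q : R j // q ≠ rej j}) Q' ⊕
      PropForm (EncVar b n Inp Out Q (fun j => {q : R j // q ≠ rej j}) Q') → Bool}
    (h : (constraintSystem A B rej A' s₀).IsSat α) :
    ∃ T : TransSys (Fin b) Inp Out, IsExtracted α s₀ T ∧ T.Models φ ∧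
      (constraintSystem A B rej A' s₀).weight α ≤ T.score ψ := by
  classical
  have hhard := MaxSAT.IsSat.holds_hard h
  obtain ⟨T, rfl, hT⟩ := exists_reads hhard.1 s₀
  refine ⟨T, ⟨rfl, hT.trans, hT.out⟩, hT.models_of_coBuchi hA hhard.2, ?_⟩
  rw [weight_constraintSystem h, TransSys.score]
  refine Finset.sum_le_sum fun j _ => ?_
  rw [TransSys.value_fst, TransSys.value_snd_fst, TransSys.value_snd_snd]
  gcongr ?_ + n * ?_ + n ^ 2 * ?_
  · exact ite_one_zero_le fun hs => hT.models_of_softG (hB j) hs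
  · exact ite_one_zero_le fun hs => hT.models_of_cPi (hB j) hs
  · exact ite_one_zero_le (Or.imp (hT.models_of_cPi (hB j)) fun hs =>
      hT.models_of_coBuchi (hA' j) hs)

/-- Every transition system that satisfies the hard specification is described by a satisfying
assignment whose weight is at least the score of the transition system. -/
theorem exists_isSat_of_models (hA : A.IsCoBuchiFor φ)
    (hB : ∀ j, (B j).IsSafetyFor (rej j) (ψ j).globally)
    (hA' : ∀ j, (A' j).IsCoBuchiFor (ψ j).eventually.globally)
    {S : Type*} [Finite S] {T : TransSys S Inp Out} (hcard : Nat.card S ≤ b) (hT : T.Models φ) :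
    ∃ α, (constraintSystem A B rej A' s₀).IsSat α ∧
      T.score ψ ≤ (constraintSystem A B rej A' s₀).weight α := by
  classical
  obtain ⟨T', rfl, htr⟩ := T.exists_fin_isTrace_iff hcard s₀
  rw [← TransSys.models_congr htr] at hT
  obtain ⟨a, ha, hlam, hsoft⟩ := exists_assignment hA hB hA' T'
  have hsat : (constraintSystem A B rej A' T'.init).IsSat (extend a) :=
    isSat_extend ⟨ha.holds_cTau, hlam hT⟩
  refine ⟨_, hsat, ?_⟩
  rw [weight_constraintSystem hsat, ← TransSys.score_congr htr, TransSys.score]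
  refine Finset.sum_le_sum fun j _ => ?_
  rw [TransSys.value_fst, TransSys.value_snd_fst, TransSys.value_snd_snd]
  gcongr ?_ + n * ?_ + n ^ 2 * ?_
  · exact ite_one_zero_le (hsoft j).1
  · exact ite_one_zero_le (hsoft j).2.1
  · exact ite_one_zero_le (Or.imp (hsoft j).2.1 (hsoft j).2.2)

end Enc

end MaxReal

theorem mainTheorem2
    {Inp Out Q : Type*} [Finite Inp] [Finite Out] [Finite Q]
    {n : ℕ} {R Q' : Fin n → Type*} [∀ j, Finite (R j)] [∀ j, Finite (Q' j)]
    (φ : MaxReal.LTL (Inp ⊕ Out)) (ψ : Fin n → MaxReal.LTL (Inp ⊕ Out))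
    (A : MaxReal.Automaton Q (Finset (Inp ⊕ Out))) (hA : A.IsCoBuchiFor φ)
    (B : ∀ j, MaxReal.Automaton (R j) (Finset (Inp ⊕ Out))) (rej : ∀ j, R j)
    (hB : ∀ j, (B j).IsSafetyFor (rej j) (ψ j).globally)
    (A' : ∀ j, MaxReal.Automaton (Q' j) (Finset (Inp ⊕ Out)))
    (hA' : ∀ j, (A' j).IsCoBuchiFor (ψ j).eventually.globally)
    (b : ℕ) (hb : 0 < b) :
    ((MaxReal.Enc.constraintSystem A B rej A' (⟨0, hb⟩ : Fin b)).Satisfiable ↔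
      ∃ (S : Type) (_ : Finite S) (T : MaxReal.TransSys S Inp Out),
        Nat.card S ≤ b ∧ T.Models φ) ∧
    ((MaxReal.Enc.constraintSystem A B rej A' (⟨0, hb⟩ : Fin b)).Satisfiable →
      ∃ α, (MaxReal.Enc.constraintSystem A B rej A' (⟨0, hb⟩ : Fin b)).IsOptimal α) ∧
    ∀ α, (MaxReal.Enc.constraintSystem A B rej A' (⟨0, hb⟩ : Fin b)).IsOptimal α →
      ∃ Topt : MaxReal.TransSys (Fin b) Inp Out,
        MaxReal.IsExtracted α ⟨0, hb⟩ Topt ∧ Topt.Models φ ∧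
        ∀ (S : Type) [Finite S] (T : MaxReal.TransSys S Inp Out),
          Nat.card S ≤ b → T.Models φ → T.valueConj ψ ≤ Topt.valueConj ψ := by
  refine ⟨⟨?_, ?_⟩, MaxReal.MaxSAT.Satisfiable.exists_isOptimal, ?_⟩
  · rintro ⟨α, hα⟩
    obtain ⟨T, -, hT, -⟩ := MaxReal.Enc.exists_transSys_of_isSat hA hB hA' hα
    exact ⟨Fin b, inferInstance, T, by simp, hT⟩
  · rintro ⟨S, _, T, hcard, hT⟩
    obtain ⟨α, hα, -⟩ := MaxReal.Enc.exists_isSat_of_models hA hB hA' hcard hT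
    exact ⟨α, hα⟩
  · rintro α ⟨hα, hopt⟩
    obtain ⟨T', hext, hT', hw'⟩ := MaxReal.Enc.exists_transSys_of_isSat hA hB hA' hα
    refine ⟨T', hext, hT', fun S _ T hcard hT => ?_⟩
    obtain ⟨β, hβ, hw⟩ := MaxReal.Enc.exists_isSat_of_models hA hB hA' hcard hT
    exact MaxReal.TransSys.valueConj_le_of_score_le (hw.trans ((hopt β hβ).trans hw'))
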